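/- Let $G$ be a locally compact, second countable (Hausdorff) amenable group with left Haar measure $m$, and let $\Gamma$ be a countable dense subgroup of $G$. A (left) Følner sequence is a sequence $\Phi = (\Phi_N)$ of compact subsets of $G$ with $m(\Phi_N) > 0$ and $m(\Phi_N \triangle g\Phi_N)/m(\Phi_N) \to 0$ as $N \to \infty$ for each $g \in G$. A system is a probability space $(X,\mathscr{B},\mu)$, with $\mathscr{B}$ countably generated and separating points, together with a jointly measurable, $\mu$-preserving action $T$ of $G$; write $(T^g f)(x) = f(T^g x)$, and let all $L^p$ spaces be real. Let $\mathbf{X} = (X,\mathscr{B},\mu,T)$ be an extension of a system $\mathbf{Y} = (Y,\mathscr{D},\lambda,S)$, i.e. let $\pi : X \to Y$ be measurable and measure-preserving with $\pi(T^g x) = S^g(\pi x)$ for all $g \in G$ and $x \in X$. Let $\mathbb{E}(\cdot\,|\,\mathbf{Y})$ be the conditional expectation on $\pi^{-1}\mathscr{D}$, regarded as a function on $Y$, and for $h \in L^2(\mathbf{X})$ put $\|h\|_y = \mathbb{E}(|h|^2\,|\,\mathbf{Y})(y)^{1/2}$, which is for almost every $y$ the norm of $h$ in $L^2(X,\mathscr{B},\mu_y)$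 when $(\mu_y)$ is a disintegration of $\mu$ over $\mathbf{Y}$. Call $f \in L^2(\mathbf{X})$ almost-periodic over $\mathbf{Y}$ if for every $\epsilon > 0$ there are a finite set $\Xi \subset L^\infty(\mathbf{X})$ and a measurable $E \subset Y$ with $\lambda(E) > 1 - \epsilon$ such that $\min\{ \|T^\gamma f - \xi\|_y : \xi \in \Xi \} \le \epsilon$ for each $\gamma \in \Gamma$ and almost every $y \in E$. Let $\mathcal{A}(\mathbf{X}|\mathbf{Y})$ be the closure in $L^2(\mathbf{X})$ of the set of almost-periodic functions. For a Følner sequence $\Phi$ let $\mathcal{W}_\Phi(\mathbf{X}|\mathbf{Y})$ be the set of $f \in L^2(\mathbf{X})$ such that $$\lim_{N \to \infty} \frac{1}{m(\Phi_N)} \int_{\Phi_N} \int_X |\mathbb{E}(\phi \cdot T^g f\,|\,\mathbf{Y})|^2 \, d\mu \, dm(g) = 0 \quad \text{for every } \phi \in L^\infty(\mathbf{X}).$$ Then, for every Følner sequence $\Phi$, the sets $\mathcal{A}(\mathbf{X}|\mathbf{Y})$ and $\mathcal{W}_\Phi(\mathbf{X}|\mathbf{Y})$ are closed linear subspaces of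 $L^2(\mathbf{X})$ and $$L^2(\mathbf{X}) = \mathcal{A}(\mathbf{X}|\mathbf{Y}) \oplus \mathcal{W}_\Phi(\mathbf{X}|\mathbf{Y})$$ is an orthogonal direct sum. Consequently $\mathcal{W}_\Phi(\mathbf{X}|\mathbf{Y})$ does not depend on $\Phi$: $\mathcal{W}_\Phi(\mathbf{X}|\mathbf{Y}) = \mathcal{W}_\Psi(\mathbf{X}|\mathbf{Y})$ for any two Følner sequences $\Phi, \Psi$. -/

import Mathlib

open MeasureTheory Filter Topology
open scoped ENNReal symmDiff Pointwise

noncomputable section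

/-- `Φ` is a left Følner sequence in `G` with respect to the left Haar measure `haar`: a sequence
of compact sets of positive measure with `haar (Φ N ∆ g Φ N) / haar (Φ N) → 0` for every `g`. -/
structure IsLeftFolner {G : Type*} [Group G] [TopologicalSpace G] [MeasurableSpace G]
    (haar : Measure G) (Φ : ℕ → Set G) : Prop where
  isCompact : ∀ N, IsCompact (Φ N)
  pos : ∀ N, 0 < haar (Φ N)
  tendsto : ∀ g : G, Tendsto (fun N => haar (Φ N ∆ (g • Φ N)) / haar (Φ N)) atTop (𝓝 0)

/-- `π : X → Y` is a factor map between the measure-preserving `G`-actions on `(X, μ)` and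
`(Y, ν)`; that is, it exhibits `(X, μ)` as an extension of `(Y, ν)`. -/
structure IsFactorMap (G : Type*) {X Y : Type*} [SMul G X] [SMul G Y]
    [MeasurableSpace X] [MeasurableSpace Y]
    (μ : Measure X) (ν : Measure Y) (π : X → Y) : Prop where
  measurePreserving : MeasurePreserving π μ ν
  equivariant : ∀ (g : G) (x : X), π (g • x) = g • π x

/-- The operator `(T^g f)(x) = f (g • x)` on `L²(X, μ)`. -/
def koopman {G X : Type*} [Group G] [MeasurableSpace G] [MeasurableSpace X] [MulAction G X]
    [MeasurableSMul₂ G X] (μ : Measure X) [SMulInvariantMeasure G X μ]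
    (g : G) (f : Lp ℝ 2 μ) : Lp ℝ 2 μ :=
  Lp.compMeasurePreserving (fun x => g • x) (measurePreserving_smul g μ) f

/-- The conditional expectation `E(h | Y)` of `h` on the factor `π : X → Y`. A function of
`y ∈ Y` is identified with its lift to `X` along `π`. -/
def factorCondExp {X Y : Type*} [MeasurableSpace X] [mY : MeasurableSpace Y]
    (μ : Measure X) (π : X → Y) (h : X → ℝ) : X → ℝ :=
  μ[h | MeasurableSpace.comap π mY]

/-- The fibre norm `‖h‖_y` at `y = π x`, for `h` square-integrable. If `μ_y` is a disintegration
of `μ` over `Y` then `E(h² | Y)(y) = ∫ h² dμ_y` almost surely, so this is the norm of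
`L²(X, μ_y)`; the expression below does not require a disintegration to exist. -/
def fibreNorm {X Y : Type*} [MeasurableSpace X] [MeasurableSpace Y]
    (μ : Measure X) (π : X → Y) (h : X → ℝ) (x : X) : ℝ :=
  Real.sqrt (factorCondExp μ π (fun z => h z ^ 2) x)

/-- `f ∈ L²(X)` is almost-periodic for the extension `π : X → Y`: for every `ε > 0` there are a
finite set `Ξ ⊆ L^∞(X)` and `E ⊆ Y` of measure greater than `1 - ε` such that
`min {‖T^γ f - ξ‖_y : ξ ∈ Ξ} ≤ ε` for every `γ ∈ Γ` and almost every `y ∈ E`. -/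
def IsAlmostPeriodic {G X Y : Type*} [Group G] [MeasurableSpace G]
    [MeasurableSpace X] [MeasurableSpace Y] [MulAction G X] [MeasurableSMul₂ G X]
    (Γ : Subgroup G) (μ : Measure X) [SMulInvariantMeasure G X μ] (ν : Measure Y) (π : X → Y)
    (f : Lp ℝ 2 μ) : Prop :=
  ∀ ε : ℝ, 0 < ε →
    ∃ (Ξ : Finset (Lp ℝ ∞ μ)) (E : Set Y), MeasurableSet E ∧ 1 - ε < ν.real E ∧
      ∀ γ ∈ Γ, ∀ᵐ x ∂μ, π x ∈ E →
        ∃ ξ ∈ Ξ, fibreNorm μ π (fun z => koopman μ γ f z - ξ z) x ≤ ε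

/-- `AP(X | Y)`: the closure in `L²(X)` of the set of almost-periodic functions. -/
def AP {G X Y : Type*} [Group G] [MeasurableSpace G]
    [MeasurableSpace X] [MeasurableSpace Y] [MulAction G X] [MeasurableSMul₂ G X]
    (Γ : Subgroup G) (μ : Measure X) [SMulInvariantMeasure G X μ] (ν : Measure Y) (π : X → Y) :
    Set (Lp ℝ 2 μ) :=
  closure {f | IsAlmostPeriodic Γ μ ν π f}

/-- `W(X | Y)`: the set of `f ∈ L²(X)` that are weakly mixing for the extension `π : X → Y`,
with averages taken along `Φ`: for every `φ ∈ L^∞(X)`,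
`(1 / haar (Φ N)) ∫_{Φ N} ∫ |E(φ · T^g f | Y)|² dμ dhaar(g) → 0`. -/
def WM {G X Y : Type*} [Group G] [MeasurableSpace G]
    [MeasurableSpace X] [MeasurableSpace Y] [MulAction G X] [MeasurableSMul₂ G X]
    (haar : Measure G) (Φ : ℕ → Set G)
    (μ : Measure X) [SMulInvariantMeasure G X μ] (π : X → Y) : Set (Lp ℝ 2 μ) :=
  {f | ∀ φ : Lp ℝ ∞ μ,
    Tendsto
      (fun N => (haar.real (Φ N))⁻¹ *
        ∫ g in Φ N, (∫ x, |factorCondExp μ π (fun z => φ z * koopman μ g f z) x| ^ 2 ∂μ) ∂haar)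
      atTop (𝓝 0)}

end

/-!
# The relative Koopman–von Neumann decomposition for amenable groups

Write `T^g f` for the translate `x ↦ f (g • x)` and `E` for the conditional expectation onto the
factor `Y`. The proof shows that the weakly mixing functions along any Følner sequence are exactly
the orthogonal complement of the almost-periodic functions; closedness, the direct sum and the
independence of the Følner sequence are then properties of orthogonal complements.

*Weakly mixing functions are orthogonal to almost-periodic ones*
(`inner_eq_zero_of_isAlmostPeriodic_of_mem_WM`). If `h` is weakly mixing, then by continuity of the
Koopman representation and density of `Γ` there is `γ ∈ Γ` for which `T^γ h` is nearly conditionally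
orthogonal to a given finite net. As `T^γ f` is fibrewise close to the net off a small part of the
factor, `⟪f, h⟫ = ⟪T^γ f, T^γ h⟫` is small.

*Functions orthogonal to the almost-periodic ones are weakly mixing*
(`IsFactorMap.mem_WM_of_forall_inner_eq_zero`). Restricting to a set coming from the factor, one may
assume that `E(f²)` is bounded. To finitely supported weights `c` on `G` one associates the fibrewise
finite-rank operator `w ↦ ∑ g, c g • E(T^g f * w) * T^g f` (`hsOp`). Its squared conditional
Hilbert–Schmidt norm is the explicit expression `hsSq`, and the integral of that is a quadratic form
`hsForm` in the weights; in this way neither a disintegration of the measure nor a relative product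
is needed, and all fibrewise inequalities come from `ae_exists_gram`, which represents conditional
Gram matrices by vectors in `ℝⁿ`. On the weights of total mass one, take a minimising sequence for
`hsForm`. By the parallelogram law it is Cauchy and asymptotically invariant under translation, so the
operators applied to `f` converge to some `F ∈ L²` whose translates are, off one small part of the
factor, fibrewise close to the range of a single finite-rank operator on functions of bounded fibre
norm. Hence `F` is almost periodic. By minimality `⟪F, f⟫` is the minimum of `hsForm`, so if `f` is
orthogonal to the almost-periodic functions, then this minimum is zero
(`IsFactorMap.exists_hsForm_lt`). Since the quadratic form of an operator is bounded by its
Hilbert–Schmidt norm, some weighted average over `h` of `∫ E(φ * T^{hg} f)²` is then small uniformly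
in `g`, and Følner averages do not see the translation by `h`
(`IsFactorMap.mem_WM_of_forall_hsForm_lt`).
-/

open MeasureTheory Filter Topology
open scoped ENNReal symmDiff Pointwise

set_option linter.unusedSectionVars false

noncomputable section

/-! ### Frobenius norm of weighted sums of rank-one forms -/

section Algebra

variable {ι κ : Type*} [Fintype κ] (s : Finset ι) (d : ι → ℝ) (b : ι → κ → ℝ) (w : κ → ℝ)

/-- The squared Frobenius norm of the matrix `∑ i, d i • b i (b i)ᵀ`, computed from the Gram matrix
of the vectors `b i`. -/
lemma sum_mul_gram_sq :
    ∑ i ∈ s, ∑ j ∈ s, d i * d j * (∑ k, b i k * b j k) ^ 2 =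
      ∑ k, ∑ l, (∑ i ∈ s, d i * b i k * b i l) ^ 2 := by
  simp only [sq, Finset.sum_mul_sum]
  simp only [Finset.mul_sum]
  calc _ = ∑ i ∈ s, ∑ k, ∑ l, ∑ j ∈ s, d i * d j * (b i k * b j k * (b i l * b j l)) := by
        refine Finset.sum_congr rfl fun i _ => ?_
        rw [Finset.sum_comm]
        exact Finset.sum_congr rfl fun k _ => Finset.sum_comm
    _ = ∑ k, ∑ l, ∑ i ∈ s, ∑ j ∈ s, d i * d j * (b i k * b j k * (b i l * b j l)) := by
        rw [Finset.sum_comm]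
        exact Finset.sum_congr rfl fun k _ => Finset.sum_comm
    _ = _ := by
        refine Finset.sum_congr rfl fun k _ => Finset.sum_congr rfl fun l _ =>
          Finset.sum_congr rfl fun i _ => Finset.sum_congr rfl fun j _ => ?_
        ring

lemma sum_mul_gram_sq_nonneg :
    0 ≤ ∑ i ∈ s, ∑ j ∈ s, d i * d j * (∑ k, b i k * b j k) ^ 2 := by
  rw [sum_mul_gram_sq]; positivity

/-- `A *ᵥ w` for `A = ∑ i, d i • b i (b i)ᵀ`, coordinate by coordinate. -/
lemma sum_rankOne_apply (k : κ) :
    ∑ i ∈ s, d i * (∑ l, w l * b i l) * b i k = ∑ l, (∑ i ∈ s, d i * b i k * b i l) * w l := by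
  simp only [Finset.sum_mul, Finset.mul_sum]
  rw [Finset.sum_comm]
  exact Finset.sum_congr rfl fun l _ => Finset.sum_congr rfl fun i _ => by ring

/-- The operator norm of `∑ i, d i • b i (b i)ᵀ` is at most its Frobenius norm. -/
lemma norm_sum_rankOne_apply_le :
    ∑ i ∈ s, ∑ j ∈ s, d i * d j * (∑ k, w k * b i k) * (∑ k, w k * b j k) *
        (∑ k, b i k * b j k) ≤
      (∑ k, w k * w k) * ∑ i ∈ s, ∑ j ∈ s, d i * d j * (∑ k, b i k * b j k) ^ 2 := by
  have h1 : ∑ i ∈ s, ∑ j ∈ s, d i * d j * (∑ k, w k * b i k) * (∑ k, w k * b j k) *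
        (∑ k, b i k * b j k) =
      ∑ k, (∑ i ∈ s, d i * (∑ l, w l * b i l) * b i k) ^ 2 := by
    simp only [sq, Finset.sum_mul_sum]
    symm
    rw [Finset.sum_comm]
    refine Finset.sum_congr rfl fun i _ => ?_
    rw [Finset.sum_comm]
    refine Finset.sum_congr rfl fun j _ => ?_
    rw [Finset.mul_sum _ _ (_ * _)]
    exact Finset.sum_congr rfl fun k _ => by ring
  rw [h1, sum_mul_gram_sq, Finset.mul_sum]
  refine Finset.sum_le_sum fun k _ => ?_
  rw [sum_rankOne_apply, mul_comm]
  refine (Finset.sum_mul_sq_le_sq_mul_sq _ _ _).trans_eq ?_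
  simp only [sq]

/-- The quadratic form of `∑ i, d i • b i (b i)ᵀ` is bounded by its Frobenius norm. -/
lemma sq_sum_rankOne_le :
    (∑ i ∈ s, d i * (∑ k, w k * b i k) ^ 2) ^ 2 ≤
      (∑ k, w k * w k) ^ 2 * ∑ i ∈ s, ∑ j ∈ s, d i * d j * (∑ k, b i k * b j k) ^ 2 := by
  have h1 : ∑ i ∈ s, d i * (∑ k, w k * b i k) ^ 2 =
      ∑ k, w k * ∑ i ∈ s, d i * (∑ l, w l * b i l) * b i k := by
    simp only [Finset.mul_sum (s := s)]
    rw [Finset.sum_comm]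
    refine Finset.sum_congr rfl fun i _ => ?_
    rw [sq, ← mul_assoc, Finset.mul_sum]
    exact Finset.sum_congr rfl fun k _ => by ring
  have h2 : ∑ k, (∑ i ∈ s, d i * (∑ l, w l * b i l) * b i k) ^ 2 ≤
      (∑ k, w k * w k) * ∑ i ∈ s, ∑ j ∈ s, d i * d j * (∑ k, b i k * b j k) ^ 2 := by
    rw [sum_mul_gram_sq, Finset.mul_sum]
    refine Finset.sum_le_sum fun k _ => ?_
    rw [sum_rankOne_apply, mul_comm]
    refine (Finset.sum_mul_sq_le_sq_mul_sq _ _ _).trans_eq ?_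
    simp only [sq]
  rw [h1]
  refine (Finset.sum_mul_sq_le_sq_mul_sq _ _ _).trans ?_
  rw [sq (∑ k, w k * w k), mul_assoc]
  have : ∑ k, w k ^ 2 = ∑ k, w k * w k := by simp only [sq]
  rw [this]
  exact mul_le_mul_of_nonneg_left h2 (Finset.sum_nonneg fun k _ => mul_self_nonneg _)

end Algebra

/-! ### The conditional inner product -/

section CondInner

variable {X : Type*} {m mX : MeasurableSpace X} {μ : Measure X}

/-- The conditional inner product `E(u w | m)`; on the fibres of a factor map it is the inner
product of `L²` of the fibre. -/
def condInner (m : MeasurableSpace X) {mX : MeasurableSpace X} (μ : Measure X)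
    (u w : X → ℝ) : X → ℝ :=
  μ[fun x => u x * w x | m]

lemma condInner_comm (u w : X → ℝ) : condInner m μ u w = condInner m μ w u := by
  simp only [condInner, mul_comm]

lemma condInner_congr {u u' w w' : X → ℝ} (hu : u =ᵐ[μ] u') (hw : w =ᵐ[μ] w') :
    condInner m μ u w =ᵐ[μ] condInner m μ u' w' :=
  condExp_congr_ae (by filter_upwards [hu, hw] with x h1 h2; rw [h1, h2])

lemma stronglyMeasurable_condInner (u w : X → ℝ) : StronglyMeasurable[m] (condInner m μ u w) :=
  stronglyMeasurable_condExp

lemma integrable_condInner (u w : X → ℝ) : Integrable (condInner m μ u w) μ :=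
  integrable_condExp

lemma condInner_self_nonneg (u : X → ℝ) : 0 ≤ᵐ[μ] condInner m μ u u :=
  condExp_nonneg (Eventually.of_forall fun x => mul_self_nonneg (u x))

lemma integral_condInner [IsFiniteMeasure μ] (hm : m ≤ mX) (u w : X → ℝ) :
    ∫ x, condInner m μ u w x ∂μ = ∫ x, u x * w x ∂μ :=
  integral_condExp hm

/-- Pull-out property for bounded coefficients. -/
lemma condInner_sum_sum [IsFiniteMeasure μ] (hm : m ≤ mX) {ι : Type*} (s : Finset ι)
    {p u : ι → X → ℝ} {C : ℝ} (hp : ∀ i, StronglyMeasurable[m] (p i))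
    (hpC : ∀ i, ∀ᵐ x ∂μ, |p i x| ≤ C) (hu : ∀ i, MemLp (u i) 2 μ) :
    condInner m μ (fun x => ∑ i ∈ s, p i x * u i x) (fun x => ∑ i ∈ s, p i x * u i x) =ᵐ[μ]
      fun x => ∑ i ∈ s, ∑ j ∈ s, p i x * p j x * condInner m μ (u i) (u j) x := by
  have hint : ∀ i j, Integrable (fun x => u i x * u j x) μ := fun i j => (hu i).integrable_mul (hu j)
  have hpp : ∀ i j, ∀ᵐ x ∂μ, ‖p i x * p j x‖ ≤ C * C := fun i j => by
    filter_upwards [hpC i, hpC j] with x h1 h2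
    rw [norm_mul]
    exact mul_le_mul h1 h2 (norm_nonneg _) ((abs_nonneg _).trans h1)
  have hpm : ∀ i j, StronglyMeasurable[m] (fun x => p i x * p j x) := fun i j => (hp i).mul (hp j)
  have hint2 : ∀ i j, Integrable (fun x => p i x * p j x * (u i x * u j x)) μ := fun i j =>
    (hint i j).bdd_mul ((hpm i j).mono hm).aestronglyMeasurable (hpp i j)
  have e1 : (fun x => (∑ i ∈ s, p i x * u i x) * (∑ i ∈ s, p i x * u i x)) =
      ∑ i ∈ s, ∑ j ∈ s, fun x => p i x * p j x * (u i x * u j x) := by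
    ext x
    simp only [Finset.sum_apply, Finset.sum_mul_sum]
    exact Finset.sum_congr rfl fun i _ => Finset.sum_congr rfl fun j _ => by ring
  unfold condInner
  rw [e1]
  refine (condExp_finsetSum (s := s)
    (f := fun i => ∑ j ∈ s, fun x => p i x * p j x * (u i x * u j x))
    (fun i _ => integrable_finsetSum' _ fun j _ => hint2 i j) m).trans ?_
  have h3 : ∀ i ∈ s, ∀ᵐ x ∂μ, (μ[∑ j ∈ s, fun x => p i x * p j x * (u i x * u j x)|m]) x =
      ∑ j ∈ s, p i x * p j x * (μ[fun x => u i x * u j x|m]) x := fun i _ => by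
    have h4 : ∀ j ∈ s, ∀ᵐ x ∂μ, (μ[fun x => p i x * p j x * (u i x * u j x)|m]) x =
        p i x * p j x * (μ[fun x => u i x * u j x|m]) x := fun j _ =>
      condExp_stronglyMeasurable_mul_of_bound hm (hpm i j) (hint i j) _ (hpp i j)
    filter_upwards [condExp_finsetSum (fun j _ => hint2 i j) m (s := s),
      (Finset.eventually_all s).2 h4] with x h5 h6
    rw [h5, Finset.sum_apply]
    exact Finset.sum_congr rfl fun j hj => h6 j hj
  filter_upwards [(Finset.eventually_all s).2 h3] with x hx
  rw [Finset.sum_apply]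
  exact Finset.sum_congr rfl fun i hi => hx i hi

/-- For almost every point, the conditional Gram matrix of finitely many square-integrable functions
is the Gram matrix of vectors in some `ℝⁿ`. Hence every inequality between inner products of finitely
many vectors also holds for conditional inner products, almost everywhere. -/
theorem ae_exists_gram [IsFiniteMeasure μ] (hm : m ≤ mX) {ι : Type*} (s : Finset ι)
    {u : ι → X → ℝ} (hu : ∀ i, MemLp (u i) 2 μ) :
    ∀ᵐ x ∂μ, ∃ (n : ℕ) (b : ι → Fin n → ℝ), ∀ i ∈ s, ∀ j ∈ s,
      condInner m μ (u i) (u j) x = ∑ k, b i k * b j k := by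
  classical
  have h1 : ∀ᵐ x ∂μ, ∀ a : s → ℚ,
      0 ≤ ∑ i : s, ∑ j : s, (a i : ℝ) * a j * condInner m μ (u i) (u j) x := by
    rw [ae_all_iff]
    intro a
    have h2 := condInner_sum_sum (m := m) (μ := μ) hm (Finset.univ : Finset s)
      (p := fun i _ => (a i : ℝ)) (u := fun i => u i) (C := ∑ i, |(a i : ℝ)|)
      (fun i => stronglyMeasurable_const)
      (fun i => Eventually.of_forall fun x =>
        Finset.single_le_sum (f := fun i => |(a i : ℝ)|) (fun i _ => abs_nonneg _)
          (Finset.mem_univ i))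
      (fun i => hu i)
    filter_upwards [h2, condInner_self_nonneg (m := m) (μ := μ)
      (fun x => ∑ i : s, (a i : ℝ) * u i x)] with x h3 h4
    rw [← h3]
    exact h4
  filter_upwards [h1] with x hx
  let M : Matrix s s ℝ := Matrix.of fun i j => condInner m μ (u i) (u j) x
  have hM : M.PosSemidef := by
    refine Matrix.PosSemidef.of_dotProduct_mulVec_nonneg ?_ ?_
    · ext i j
      simp [M, condInner_comm (u i) (u j)]
    · intro a
      have hd : DenseRange (fun (q : s → ℚ) (i : s) => (q i : ℝ)) :=
        DenseRange.piMap fun _ => Rat.denseRange_cast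
      refine hd.induction_on (p := fun a : s → ℝ => 0 ≤ star a ⬝ᵥ (M.mulVec a)) a ?_ ?_
      · exact isClosed_le continuous_const (by
          simp only [dotProduct, Matrix.mulVec, Pi.star_apply, star_trivial]; fun_prop)
      · intro q
        convert hx q using 1
        simp only [dotProduct, Matrix.mulVec, Pi.star_apply, star_trivial, Finset.mul_sum, M,
          Matrix.of_apply]
        exact Finset.sum_congr rfl fun i _ => Finset.sum_congr rfl fun j _ => by ring
  obtain ⟨n, v, hv⟩ := Matrix.posSemidef_iff_eq_sum_vecMulVec.1 hM
  refine ⟨n, fun i k => if h : i ∈ s then v k ⟨i, h⟩ else 0, fun i hi j hj => ?_⟩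
  have := congrFun (congrFun hv ⟨i, hi⟩) ⟨j, hj⟩
  simpa [M, Matrix.sum_apply, Matrix.vecMulVec_apply, hi, hj] using this

/-- Conditional Cauchy–Schwarz. -/
lemma sq_condInner_le [IsFiniteMeasure μ] (hm : m ≤ mX) {u w : X → ℝ} (hu : MemLp u 2 μ)
    (hw : MemLp w 2 μ) :
    ∀ᵐ x ∂μ, condInner m μ u w x ^ 2 ≤ condInner m μ u u x * condInner m μ w w x := by
  filter_upwards [ae_exists_gram (m := m) hm Finset.univ (u := fun i : Bool => if i then u else w)
    (fun i => by cases i <;> simpa)] with x ⟨n, b, hb⟩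
  have h1 := hb true (Finset.mem_univ _) false (Finset.mem_univ _)
  have h2 := hb true (Finset.mem_univ _) true (Finset.mem_univ _)
  have h3 := hb false (Finset.mem_univ _) false (Finset.mem_univ _)
  simp only [if_true, Bool.false_eq_true, if_false] at h1 h2 h3
  rw [h1, h2, h3]
  refine (Finset.sum_mul_sq_le_sq_mul_sq _ _ _).trans_eq ?_
  simp only [sq]

end CondInner

/-! ### Minimising a quadratic form over an affine hyperplane -/

section Minimize

variable {V : Type*} [AddCommGroup V] [Module ℝ V] {B : V →ₗ[ℝ] V →ₗ[ℝ] ℝ} {ℓ : V →ₗ[ℝ] ℝ}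

/-- Near-minimisers of a nonnegative quadratic form on an affine hyperplane are close to each other,
by the parallelogram law. -/
lemma form_sub_le_of_near_min {d α β : ℝ} (hd : ∀ c, ℓ c = 1 → d ≤ B c c) {a b : V}
    (ha : ℓ a = 1) (hb : ℓ b = 1) (hα : B a a ≤ d + α) (hβ : B b b ≤ d + β) :
    B (a - b) (a - b) ≤ 2 * (α + β) := by
  have h1 := hd ((1 / 2 : ℝ) • (a + b)) (by simp [ha, hb]; norm_num)
  simp only [map_smul, map_add, map_sub, LinearMap.smul_apply, LinearMap.add_apply,
    LinearMap.sub_apply, smul_eq_mul] at h1 ⊢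
  linarith

lemma exists_minimizing_seq (hB : ∀ c, 0 ≤ B c c) {e : V} (he : ℓ e = 1) :
    ∃ d : ℝ, 0 ≤ d ∧ (∀ c, ℓ c = 1 → d ≤ B c c) ∧
      ∃ c : ℕ → V, ∀ n, ℓ (c n) = 1 ∧ B (c n) (c n) ≤ d + (1 / 8) ^ n / 4 := by
  let S : Set ℝ := (fun c => B c c) '' {c | ℓ c = 1}
  have hS : S.Nonempty := ⟨_, e, he, rfl⟩
  have hbdd : BddBelow S := ⟨0, by rintro _ ⟨c, -, rfl⟩; exact hB c⟩
  refine ⟨sInf S, le_csInf hS (by rintro _ ⟨c, -, rfl⟩; exact hB c),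
    fun c hc => csInf_le hbdd ⟨c, hc, rfl⟩, ?_⟩
  have : ∀ n : ℕ, ∃ c, ℓ c = 1 ∧ B c c ≤ sInf S + (1 / 8) ^ n / 4 := fun n => by
    obtain ⟨_, ⟨c, hc, rfl⟩, h⟩ := exists_lt_of_csInf_lt hS
      (lt_add_of_pos_right (sInf S) (by positivity : (0 : ℝ) < (1 / 8) ^ n / 4))
    exact ⟨c, hc, h.le⟩
  choose c hc using this
  exact ⟨c, hc⟩

/-- If a minimising sequence becomes orthogonal to some vector of the affine hyperplane, then the
infimum vanishes: moving towards that vector would decrease the form. -/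
lemma min_eq_zero_of_tendsto {d : ℝ} (hd0 : 0 ≤ d) (hd : ∀ c, ℓ c = 1 → d ≤ B c c)
    (hsymm : ∀ a b, B a b = B b a) {c : ℕ → V} (hc : ∀ n, ℓ (c n) = 1)
    (hlim : Tendsto (fun n => B (c n) (c n)) atTop (𝓝 d)) {e : V} (he : ℓ e = 1)
    (h0 : Tendsto (fun n => B (c n) e) atTop (𝓝 0)) : d = 0 := by
  have key : ∀ t : ℝ, d ≤ (1 - t) ^ 2 * d + 2 * t * (1 - t) * 0 + t ^ 2 * B e e := fun t => by
    have h1 : Tendsto (fun n => (1 - t) ^ 2 * B (c n) (c n) + 2 * t * (1 - t) * B (c n) e +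
        t ^ 2 * B e e) atTop (𝓝 ((1 - t) ^ 2 * d + 2 * t * (1 - t) * 0 + t ^ 2 * B e e)) :=
      ((hlim.const_mul _).add (h0.const_mul _)).add_const _
    refine ge_of_tendsto' h1 fun n => ?_
    have h2 := hd ((1 - t) • c n + t • e) (by simp [hc n, he])
    have h3 := hsymm e (c n)
    simp only [map_smul, map_add, LinearMap.smul_apply, LinearMap.add_apply, smul_eq_mul, h3] at h2
    linarith
  have hq : 0 ≤ B e e := hd0.trans (hd e he)
  -- the optimal choice of the parameter is `d / (d + B e e)`
  by_contra hne
  have hdpos : 0 < d := lt_of_le_of_ne hd0 (Ne.symm hne)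
  have hs : 0 < d + B e e := by linarith
  have h2 := key (d / (d + B e e))
  have h3 : d / (d + B e e) * (d + B e e) = d := div_mul_cancel₀ _ hs.ne'
  have h4 : 0 < d / (d + B e e) := div_pos hdpos hs
  nlinarith [mul_pos h4 hdpos]

end Minimize

/-! ### Conditional Hilbert–Schmidt forms of finite-rank operators -/

section HilbertSchmidt

/-- The bilinear form on finitely supported functions with kernel `κ`. -/
def kernelForm {G : Type*} (κ : G → G → ℝ) : (G →₀ ℝ) →ₗ[ℝ] (G →₀ ℝ) →ₗ[ℝ] ℝ :=
  Finsupp.linearCombination ℝ fun g => Finsupp.linearCombination ℝ (κ g)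

lemma kernelForm_apply {G : Type*} (κ : G → G → ℝ) (c d : G →₀ ℝ) :
    kernelForm κ c d = ∑ g ∈ c.support, ∑ h ∈ d.support, c g * d h * κ g h := by
  simp only [kernelForm, Finsupp.linearCombination_apply, Finsupp.sum, LinearMap.sum_apply,
    LinearMap.smul_apply, smul_eq_mul, Finset.mul_sum, mul_assoc]

lemma kernelForm_comm {G : Type*} {κ : G → G → ℝ} (hκ : ∀ g h, κ g h = κ h g) (c d : G →₀ ℝ) :
    kernelForm κ c d = kernelForm κ d c := by
  rw [kernelForm_apply, kernelForm_apply, Finset.sum_comm]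
  exact Finset.sum_congr rfl fun g _ => Finset.sum_congr rfl fun h _ => by rw [hκ]; ring

variable {G X : Type*} {m mX : MeasurableSpace X} {μ : Measure X} {v : G → X → ℝ}

/-- For `c` finitely supported, the squared Hilbert–Schmidt norm on the fibre through `x` of the
operator `w ↦ ∑ g, c g • E(v g * w | m) * v g`. -/
def hsSq (m : MeasurableSpace X) {mX : MeasurableSpace X} (μ : Measure X) (v : G → X → ℝ)
    (c : G →₀ ℝ) (x : X) : ℝ :=
  kernelForm (fun g h => condInner m μ (v g) (v h) x ^ 2) c c

/-- The bilinear form whose quadratic form is the integral of `hsSq`. -/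
def hsForm (m : MeasurableSpace X) {mX : MeasurableSpace X} (μ : Measure X) (v : G → X → ℝ) :
    (G →₀ ℝ) →ₗ[ℝ] (G →₀ ℝ) →ₗ[ℝ] ℝ :=
  kernelForm fun g h => ∫ x, condInner m μ (v g) (v h) x ^ 2 ∂μ

/-- The function `∑ g, c g • E(v g * w | m) * v g`: a fibrewise finite-rank operator, linear in the
weights `c`, applied to `w`. -/
def hsOp (m : MeasurableSpace X) {mX : MeasurableSpace X} (μ : Measure X) (v : G → X → ℝ)
    (w : X → ℝ) : (G →₀ ℝ) →ₗ[ℝ] (X → ℝ) :=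
  Finsupp.linearCombination ℝ fun g x => condInner m μ (v g) w x * v g x

lemma hsOp_apply (w : X → ℝ) (c : G →₀ ℝ) (x : X) :
    hsOp m μ v w c x = ∑ g ∈ c.support, c g * condInner m μ (v g) w x * v g x := by
  simp [hsOp, Finsupp.linearCombination_apply, Finsupp.sum, mul_assoc]

lemma hsSq_apply (c : G →₀ ℝ) (x : X) : hsSq m μ v c x =
    ∑ g ∈ c.support, ∑ h ∈ c.support, c g * c h * condInner m μ (v g) (v h) x ^ 2 :=
  kernelForm_apply _ _ _

lemma hsForm_comm (a b : G →₀ ℝ) : hsForm m μ v a b = hsForm m μ v b a :=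
  kernelForm_comm (fun g h => by simp only [condInner_comm (v g)]) a b

lemma stronglyMeasurable_hsSq (c : G →₀ ℝ) : StronglyMeasurable[m] (hsSq m μ v c) := by
  have : hsSq m μ v c = fun x => ∑ g ∈ c.support, ∑ h ∈ c.support,
      c g * c h * condInner m μ (v g) (v h) x ^ 2 := funext (hsSq_apply c)
  rw [this]
  exact Finset.stronglyMeasurable_fun_sum _ fun g _ => Finset.stronglyMeasurable_fun_sum _
    fun h _ => stronglyMeasurable_const.mul ((stronglyMeasurable_condInner _ _).pow 2)

variable [IsFiniteMeasure μ] (hm : m ≤ mX) {C : ℝ}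

include hm in
lemma ae_abs_condInner_le (hC0 : 0 ≤ C) {u w : X → ℝ} (hu : MemLp u 2 μ) (hw : MemLp w 2 μ)
    (huC : ∀ᵐ x ∂μ, condInner m μ u u x ≤ C) (hwC : ∀ᵐ x ∂μ, condInner m μ w w x ≤ C) :
    ∀ᵐ x ∂μ, |condInner m μ u w x| ≤ C := by
  filter_upwards [sq_condInner_le hm hu hw, huC, hwC, condInner_self_nonneg (m := m) (μ := μ) u,
    condInner_self_nonneg (m := m) (μ := μ) w] with x h1 h2 h3 h4 h5
  refine abs_le_of_sq_le_sq (h1.trans ?_) hC0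
  rw [sq]
  exact mul_le_mul h2 h3 h5 hC0

variable (hv : ∀ g, MemLp (v g) 2 μ)

include hm hv in
lemma hsSq_nonneg (c : G →₀ ℝ) : ∀ᵐ x ∂μ, 0 ≤ hsSq m μ v c x := by
  filter_upwards [ae_exists_gram hm c.support hv] with x ⟨n, b, hb⟩
  rw [hsSq_apply]
  refine (sum_mul_gram_sq_nonneg c.support c b).trans_eq ?_
  exact Finset.sum_congr rfl fun i hi => Finset.sum_congr rfl fun j hj => by rw [hb i hi j hj]

lemma hsSq_add_le (hm : m ≤ mX) (hv : ∀ g, MemLp (v g) 2 μ) (a b : G →₀ ℝ) :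
    ∀ᵐ x ∂μ, hsSq m μ v (a + b) x ≤ 2 * hsSq m μ v a x + 2 * hsSq m μ v b x := by
  filter_upwards [hsSq_nonneg hm hv (a - b)] with x hx
  unfold hsSq at *
  simp only [map_sub, map_add, LinearMap.add_apply, LinearMap.sub_apply] at *
  linarith

include hm hv in
lemma ae_gram_option {w : X → ℝ} (hw : MemLp w 2 μ) (s : Finset G) :
    ∀ᵐ x ∂μ, ∃ (n : ℕ) (w' : Fin n → ℝ) (b : G → Fin n → ℝ),
      (condInner m μ w w x = ∑ k, w' k * w' k) ∧
      (∀ g ∈ s, condInner m μ (v g) w x = ∑ k, w' k * b g k) ∧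
      ∀ g ∈ s, ∀ h ∈ s, condInner m μ (v g) (v h) x = ∑ k, b g k * b h k := by
  filter_upwards [ae_exists_gram hm (Finset.insertNone s)
    (u := fun i : Option G => i.elim w v) (fun i => by cases i <;> simp [hw, hv])]
    with x ⟨n, b, hb⟩
  refine ⟨n, b none, fun g => b (some g), ?_, fun g hg => ?_, fun g hg h hh => ?_⟩
  · simpa using hb none (by simp) none (by simp)
  · rw [condInner_comm]
    simpa using hb none (by simp) (some g) (by simpa using hg)
  · simpa using hb (some g) (by simpa using hg) (some h) (by simpa using hh)

include hm hv in
/-- The quadratic form of the fibrewise operator is bounded by its Hilbert–Schmidt norm. -/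
lemma sq_sum_condInner_sq_le {w : X → ℝ} (hw : MemLp w 2 μ) (c : G →₀ ℝ) :
    ∀ᵐ x ∂μ, (∑ g ∈ c.support, c g * condInner m μ (v g) w x ^ 2) ^ 2 ≤
      condInner m μ w w x ^ 2 * hsSq m μ v c x := by
  filter_upwards [ae_gram_option hm hv hw c.support] with x ⟨n, w', b, h1, h2, h3⟩
  rw [hsSq_apply, h1]
  convert sq_sum_rankOne_le c.support c b w' using 2
  · exact Finset.sum_congr rfl fun i hi => by rw [h2 i hi]
  · exact Finset.sum_congr rfl fun i hi => Finset.sum_congr rfl fun j hj => by rw [h3 i hi j hj]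

variable (hC0 : 0 ≤ C) (hC : ∀ g, ∀ᵐ x ∂μ, condInner m μ (v g) (v g) x ≤ C)

include hm hv hC0 hC in
lemma integrable_condInner_sq (g h : G) : Integrable (fun x => condInner m μ (v g) (v h) x ^ 2) μ := by
  refine Integrable.of_bound (C := C ^ 2)
    (((stronglyMeasurable_condInner _ _).mono hm).pow 2).aestronglyMeasurable ?_
  filter_upwards [ae_abs_condInner_le hm hC0 (hv g) (hv h) (hC g) (hC h)] with x hx
  rw [norm_pow]
  exact pow_le_pow_left₀ (norm_nonneg _) hx 2

include hm hv hC0 hC in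
lemma integrable_hsSq (c : G →₀ ℝ) : Integrable (hsSq m μ v c) μ := by
  have : hsSq m μ v c = fun x => ∑ g ∈ c.support, ∑ h ∈ c.support,
      c g * c h * condInner m μ (v g) (v h) x ^ 2 := funext (hsSq_apply c)
  rw [this]
  exact integrable_finsetSum _ fun g _ => integrable_finsetSum _
    fun h _ => (integrable_condInner_sq hm hv hC0 hC g h).const_mul _

include hm hv hC0 hC in
lemma integral_hsSq (c : G →₀ ℝ) : ∫ x, hsSq m μ v c x ∂μ = hsForm m μ v c c := by
  simp only [hsSq_apply, hsForm, kernelForm_apply]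
  rw [integral_finsetSum _ fun g _ => integrable_finsetSum _
    fun h _ => (integrable_condInner_sq hm hv hC0 hC g h).const_mul _]
  refine Finset.sum_congr rfl fun g _ => ?_
  rw [integral_finsetSum _ fun h _ => (integrable_condInner_sq hm hv hC0 hC g h).const_mul _]
  exact Finset.sum_congr rfl fun h _ => integral_const_mul _ _

include hm hv hC0 hC in
lemma hsForm_self_nonneg (c : G →₀ ℝ) : 0 ≤ hsForm m μ v c c := by
  rw [← integral_hsSq hm hv hC0 hC]
  exact integral_nonneg_of_ae (hsSq_nonneg hm hv c)

include hm hv hC0 hC in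
lemma memLp_hsOp {w : X → ℝ} (hw : MemLp w 2 μ) (hwC : ∀ᵐ x ∂μ, condInner m μ w w x ≤ C)
    (c : G →₀ ℝ) : MemLp (hsOp m μ v w c) 2 μ := by
  have : hsOp m μ v w c = fun x => ∑ g ∈ c.support, (c g * condInner m μ (v g) w x) * v g x :=
    funext (hsOp_apply w c)
  rw [this]
  refine memLp_finsetSum _ fun g _ => ?_
  refine MemLp.mul (r := 2) (p := ∞) (q := 2) (hv g) ?_
  refine (memLp_top_of_bound ((stronglyMeasurable_condInner _ _).mono hm).aestronglyMeasurable C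
    (ae_abs_condInner_le hm hC0 (hv g) hw (hC g) hwC)).const_mul (c g)

include hm hv hC0 hC in
/-- The fibrewise operator norm is bounded by the Hilbert–Schmidt norm. -/
lemma condInner_hsOp_le {w : X → ℝ} (hw : MemLp w 2 μ)
    (hwC : ∀ᵐ x ∂μ, condInner m μ w w x ≤ C) (c : G →₀ ℝ) :
    ∀ᵐ x ∂μ, condInner m μ (hsOp m μ v w c) (hsOp m μ v w c) x ≤ C * hsSq m μ v c x := by
  have : hsOp m μ v w c = fun x => ∑ g ∈ c.support, (c g * condInner m μ (v g) w x) * v g x :=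
    funext (hsOp_apply w c)
  have hb : ∀ g, ∀ᵐ x ∂μ, |c g * condInner m μ (v g) w x| ≤ (∑ g ∈ c.support, |c g|) * C :=
    fun g => by
    filter_upwards [ae_abs_condInner_le hm hC0 (hv g) hw (hC g) hwC] with x hx
    rw [abs_mul]
    refine mul_le_mul ?_ hx (abs_nonneg _) (Finset.sum_nonneg fun _ _ => abs_nonneg _)
    by_cases hg : g ∈ c.support
    · exact Finset.single_le_sum (f := fun g => |c g|) (fun _ _ => abs_nonneg _) hg
    · simp only [Finsupp.notMem_support_iff.1 hg, abs_zero]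
      exact Finset.sum_nonneg fun _ _ => abs_nonneg _
  have h1 := condInner_sum_sum hm c.support
    (p := fun g x => c g * condInner m μ (v g) w x) (u := v)
    (fun g => stronglyMeasurable_const.mul (stronglyMeasurable_condInner _ _)) hb hv
  rw [this]
  filter_upwards [h1, ae_gram_option hm hv hw c.support, hwC, hsSq_nonneg hm hv c] with
    x h1 ⟨n, w', b, h2, h3, h4⟩ h5 h6
  rw [h1]
  refine le_trans ?_ (mul_le_mul_of_nonneg_right h5 h6)
  rw [hsSq_apply, h2]
  have e : ∑ i ∈ c.support, ∑ j ∈ c.support, c i * c j * condInner m μ (v i) (v j) x ^ 2 =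
      ∑ i ∈ c.support, ∑ j ∈ c.support, c i * c j * (∑ k, b i k * b j k) ^ 2 :=
    Finset.sum_congr rfl fun i hi => Finset.sum_congr rfl fun j hj => by rw [h4 i hi j hj]
  rw [e]
  refine (Finset.sum_congr rfl fun i hi => Finset.sum_congr rfl fun j hj => ?_).trans_le
    (norm_sum_rankOne_apply_le c.support c b w')
  rw [h3 i hi, h3 j hj, h4 i hi j hj]; ring

end HilbertSchmidt

/-! ### Conditional inner products of `L²` classes -/

section CondSq

variable {X : Type*} {m mX : MeasurableSpace X} {μ : Measure X}

/-- The squared fibre norm `E(u² | m)` of `u ∈ L²`. -/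
def condSq (m : MeasurableSpace X) {mX : MeasurableSpace X} {μ : Measure X} (u : Lp ℝ 2 μ) : X → ℝ :=
  condInner m μ u u

lemma condSq_nonneg (u : Lp ℝ 2 μ) : 0 ≤ᵐ[μ] condSq m u := condInner_self_nonneg _

lemma integral_mul_self_eq_norm_sq (u : Lp ℝ 2 μ) : ∫ x, u x * u x ∂μ = ‖u‖ ^ 2 := by
  rw [← real_inner_self_eq_norm_sq, L2.inner_def]
  simp [sq]

lemma integrable_condSq (u : Lp ℝ 2 μ) : Integrable (condSq m u) μ := integrable_condInner _ _

lemma stronglyMeasurable_condSq (u : Lp ℝ 2 μ) : StronglyMeasurable[m] (condSq m u) :=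
  stronglyMeasurable_condInner _ _

lemma condSq_smul (c : ℝ) (u : Lp ℝ 2 μ) : ∀ᵐ x ∂μ, condSq m (c • u) x = c ^ 2 * condSq m u x := by
  have h1 : (fun x => (c • u : Lp ℝ 2 μ) x * (c • u : Lp ℝ 2 μ) x) =ᵐ[μ]
      c ^ 2 • fun x => u x * u x := by
    filter_upwards [Lp.coeFn_smul c u] with x hx
    simp only [hx, Pi.smul_apply, smul_eq_mul]; ring
  exact (condExp_congr_ae h1).trans (condExp_smul _ _ _)

lemma condSq_add_le (u w : Lp ℝ 2 μ) :
    ∀ᵐ x ∂μ, condSq m (u + w) x ≤ 2 * condSq m u x + 2 * condSq m w x := by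
  have iu : Integrable (fun x => u x * u x) μ := (Lp.memLp u).integrable_mul (Lp.memLp u)
  have iw : Integrable (fun x => w x * w x) μ := (Lp.memLp w).integrable_mul (Lp.memLp w)
  have iuw : Integrable (fun x => (u + w : Lp ℝ 2 μ) x * (u + w : Lp ℝ 2 μ) x) μ :=
    (Lp.memLp _).integrable_mul (Lp.memLp _)
  have h1 : (fun x => (u + w : Lp ℝ 2 μ) x * (u + w : Lp ℝ 2 μ) x) ≤ᵐ[μ]
      ((2 : ℝ) • fun x => u x * u x) + (2 : ℝ) • fun x => w x * w x := by
    filter_upwards [Lp.coeFn_add u w] with x hx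
    simp only [hx, Pi.add_apply, Pi.smul_apply, smul_eq_mul]
    nlinarith [sq_nonneg (u x - w x)]
  filter_upwards [condExp_mono (m := m) iuw ((iu.smul (2 : ℝ)).add (iw.smul (2 : ℝ))) h1,
    condExp_add (iu.smul (2 : ℝ)) (iw.smul (2 : ℝ)) m,
    condExp_smul (μ := μ) (2 : ℝ) (fun x => u x * u x) m,
    condExp_smul (μ := μ) (2 : ℝ) (fun x => w x * w x) m] with x h1 h2 h3 h4
  rw [h2, Pi.add_apply, h3, h4] at h1
  exact h1

variable [IsFiniteMeasure μ]

lemma integral_condSq (hm : m ≤ mX) (u : Lp ℝ 2 μ) : ∫ x, condSq m u x ∂μ = ‖u‖ ^ 2 := by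
  rw [condSq, integral_condInner hm, integral_mul_self_eq_norm_sq]

lemma condSq_eq_of_eq_on {u w : Lp ℝ 2 μ} {B : Set X} (hB : MeasurableSet[m] B)
    (h : ∀ᵐ x ∂μ, x ∈ B → u x = w x) : ∀ᵐ x ∂μ, x ∈ B → condSq m u x = condSq m w x := by
  have iu : Integrable (fun x => u x * u x) μ := (Lp.memLp u).integrable_mul (Lp.memLp u)
  have iw : Integrable (fun x => w x * w x) μ := (Lp.memLp w).integrable_mul (Lp.memLp w)
  have h0 : B.indicator (fun x => u x * u x) =ᵐ[μ] B.indicator (fun x => w x * w x) := by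
    filter_upwards [h] with x hx
    by_cases hxB : x ∈ B
    · simp [hxB, hx hxB]
    · simp [hxB]
  filter_upwards [condExp_indicator iu hB, condExp_indicator iw hB,
    condExp_congr_ae (m := m) h0] with x h1 h2 h3 hxB
  rw [h1, h2] at h3
  rw [Set.indicator_of_mem hxB, Set.indicator_of_mem hxB] at h3
  exact h3

/-- Markov's inequality for the squared fibre norm. -/
lemma measureReal_lt_condSq_le (hm : m ≤ mX) (u : Lp ℝ 2 μ) {δ : ℝ} (hδ : 0 < δ) :
    μ.real {x | δ < condSq m u x} ≤ ‖u‖ ^ 2 / δ := by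
  rw [le_div_iff₀' hδ, ← integral_condSq hm u]
  refine le_trans ?_ (mul_meas_ge_le_integral_of_nonneg (condSq_nonneg u) (integrable_condSq u) δ)
  exact mul_le_mul_of_nonneg_left (measureReal_mono fun x (hx : δ < _) => hx.le) hδ.le

/-- `∫ E(φ u | m)²`, the integrand in the definition of relative weak mixing. -/
def condMix (m : MeasurableSpace X) {mX : MeasurableSpace X} {μ : Measure X} (φ : Lp ℝ ∞ μ)
    (u : Lp ℝ 2 μ) : ℝ :=
  ∫ x, condInner m μ φ u x ^ 2 ∂μ

lemma condMix_nonneg (φ : Lp ℝ ∞ μ) (u : Lp ℝ 2 μ) : 0 ≤ condMix m φ u :=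
  integral_nonneg fun _ => sq_nonneg _

lemma condInner_ae_eq_condExpL2 (hm : m ≤ mX) (φ : Lp ℝ ∞ μ) (u : Lp ℝ 2 μ) :
    (condExpL2 ℝ ℝ hm (φ • u : Lp ℝ 2 μ) : X → ℝ) =ᵐ[μ] condInner m μ φ u := by
  have h := MemLp.condExpL2_ae_eq_condExp (𝕜 := ℝ) hm (Lp.memLp (φ • u : Lp ℝ 2 μ))
  rw [Lp.toLp_coeFn] at h
  refine h.trans (condExp_congr_ae ?_)
  filter_upwards [Lp.coeFn_lpSMul (r := 2) φ u] with x hx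
  rw [hx]; rfl

lemma condMix_eq_norm_sq (hm : m ≤ mX) (φ : Lp ℝ ∞ μ) (u : Lp ℝ 2 μ) :
    condMix m φ u = ‖condExpL2 ℝ ℝ hm (φ • u : Lp ℝ 2 μ)‖ ^ 2 := by
  rw [← Submodule.norm_coe, ← integral_mul_self_eq_norm_sq]
  refine integral_congr_ae ?_
  filter_upwards [condInner_ae_eq_condExpL2 hm φ u] with x hx
  rw [hx, sq]

lemma norm_condExpL2_smul_le (hm : m ≤ mX) (φ : Lp ℝ ∞ μ) (u : Lp ℝ 2 μ) :
    ‖condExpL2 ℝ ℝ hm (φ • u : Lp ℝ 2 μ)‖ ≤ ‖φ‖ * ‖u‖ :=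
  (norm_condExpL2_le hm _).trans (Lp.norm_smul_le φ u)

lemma integrable_sq_condInner (hm : m ≤ mX) (φ : Lp ℝ ∞ μ) (u : Lp ℝ 2 μ) :
    Integrable (fun x => condInner m μ φ u x ^ 2) μ := by
  have h := (Lp.memLp (condExpL2 ℝ ℝ hm (φ • u : Lp ℝ 2 μ) : Lp ℝ 2 μ)).integrable_sq
  refine h.congr ?_
  filter_upwards [condInner_ae_eq_condExpL2 hm φ u] with x hx
  rw [hx]

lemma condMix_le (hm : m ≤ mX) (φ : Lp ℝ ∞ μ) (u : Lp ℝ 2 μ) :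
    condMix m φ u ≤ (‖φ‖ * ‖u‖) ^ 2 := by
  rw [condMix_eq_norm_sq hm]
  exact pow_le_pow_left₀ (norm_nonneg _) (norm_condExpL2_smul_le hm φ u) 2

lemma condMix_add_le (hm : m ≤ mX) (φ : Lp ℝ ∞ μ) (u w : Lp ℝ 2 μ) :
    condMix m φ (u + w) ≤ 2 * condMix m φ u + 2 * condMix m φ w := by
  simp only [condMix_eq_norm_sq hm, Lp.add_smul, map_add]
  set a := condExpL2 ℝ ℝ hm (φ • u : Lp ℝ 2 μ)
  set b := condExpL2 ℝ ℝ hm (φ • w : Lp ℝ 2 μ)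
  have h := norm_add_le a b
  nlinarith [sq_nonneg (‖a‖ - ‖b‖), norm_nonneg (a + b), norm_nonneg a, norm_nonneg b]

lemma continuous_condMix (hm : m ≤ mX) (φ : Lp ℝ ∞ μ) : Continuous (condMix (μ := μ) m φ) := by
  have h : (condMix (μ := μ) m φ) = fun u => ‖condExpL2 ℝ ℝ hm (φ • u : Lp ℝ 2 μ)‖ ^ 2 :=
    funext fun u => condMix_eq_norm_sq hm φ u
  rw [h]
  refine (Continuous.norm ?_).pow 2
  refine (LipschitzWith.of_dist_le_mul (K := ‖φ‖₊) fun u w => ?_).continuous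
  rw [dist_eq_norm, dist_eq_norm, ← map_sub]
  have : (φ • u : Lp ℝ 2 μ) - φ • w = φ • (u - w) := by
    rw [sub_eq_add_neg u w, Lp.add_smul, Lp.smul_neg, sub_eq_add_neg]
  rw [this]
  exact norm_condExpL2_smul_le hm φ _

end CondSq

/-! ### The Koopman representation -/

section Koopman

variable {G X : Type*} [Group G] [MeasurableSpace G] [MeasurableSpace X] [MulAction G X]
  [MeasurableSMul₂ G X] {μ : Measure X} [SMulInvariantMeasure G X μ]

lemma coeFn_koopman (g : G) (f : Lp ℝ 2 μ) : koopman μ g f =ᵐ[μ] fun x => f (g • x) :=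
  Lp.coeFn_compMeasurePreserving f _

lemma koopman_eq_linearIsometry (g : G) (f : Lp ℝ 2 μ) : koopman μ g f =
    Lp.compMeasurePreservingₗᵢ ℝ (fun x => g • x) (measurePreserving_smul g μ) f := rfl

lemma koopman_add (g : G) (u w : Lp ℝ 2 μ) :
    koopman μ g (u + w) = koopman μ g u + koopman μ g w := by
  simp only [koopman_eq_linearIsometry, map_add]

lemma koopman_sub (g : G) (u w : Lp ℝ 2 μ) :
    koopman μ g (u - w) = koopman μ g u - koopman μ g w := by
  simp only [koopman_eq_linearIsometry, map_sub]

lemma koopman_smul (g : G) (c : ℝ) (u : Lp ℝ 2 μ) :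
    koopman μ g (c • u) = c • koopman μ g u := by
  simp only [koopman_eq_linearIsometry, map_smul]

lemma norm_koopman (g : G) (u : Lp ℝ 2 μ) : ‖koopman μ g u‖ = ‖u‖ := by
  rw [koopman_eq_linearIsometry, LinearIsometry.norm_map]

lemma inner_koopman (g : G) (u w : Lp ℝ 2 μ) :
    inner ℝ (koopman μ g u) (koopman μ g w) = inner ℝ u w := by
  rw [koopman_eq_linearIsometry, koopman_eq_linearIsometry, LinearIsometry.inner_map_map]

/-- `g ↦ T^g` reverses products, since `(T^g f)(x) = f (g • x)`. -/
lemma koopman_koopman (g h : G) (u : Lp ℝ 2 μ) :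
    koopman μ g (koopman μ h u) = koopman μ (h * g) u := by
  refine Lp.ext ?_
  filter_upwards [coeFn_koopman g (koopman μ h u), coeFn_koopman (h * g) u,
    (measurePreserving_smul g μ).quasiMeasurePreserving.ae (coeFn_koopman h u)] with x h1 h2 h3
  rw [h1, h2, h3, mul_smul]

/-- The orbit map `g ↦ T^g f` is continuous: preimages of small balls are measurable, countably
many of them cover the group because `L²` is separable, and Steinhaus's theorem turns one of
positive measure into a neighbourhood of the identity. -/
theorem continuous_koopman [TopologicalSpace G] [IsTopologicalGroup G] [LocallyCompactSpace G]
    [SecondCountableTopology G] [BorelSpace G] (haar : Measure G) [haar.IsHaarMeasure]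
    [MeasurableSpace.CountablyGenerated X] [IsFiniteMeasure μ] (f : Lp ℝ 2 μ) :
    Continuous fun g : G => koopman μ g f := by
  have : Fact ((2 : ℝ≥0∞) ≠ ∞) := ⟨by simp⟩
  have hdist : ∀ w : Lp ℝ 2 μ, Measurable fun g : G => ‖koopman μ g f - w‖ ^ 2 := fun w => by
    have h1 : ∀ g : G, ‖koopman μ g f - w‖ ^ 2 = ∫ x, (f (g • x) - w x) ^ 2 ∂μ := fun g => by
      rw [← integral_mul_self_eq_norm_sq]
      refine integral_congr_ae ?_
      filter_upwards [coeFn_koopman g f, Lp.coeFn_sub (koopman μ g f) w] with x h1 h2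
      rw [h2, Pi.sub_apply, h1, sq]
    simp only [h1]
    have hf := (Lp.stronglyMeasurable f).measurable
    have hw := (Lp.stronglyMeasurable w).measurable
    have h2 : Measurable fun p : G × X => (f (p.1 • p.2) - w p.2) ^ 2 := by fun_prop
    exact h2.stronglyMeasurable.integral_prod_right.measurable
  have hdist' : ∀ g h : G, dist (koopman μ g f) (koopman μ h f) =
      dist (koopman μ (g * h⁻¹) f) f := fun g h => by
    rw [dist_eq_norm, dist_eq_norm, ← norm_koopman h (koopman μ (g * h⁻¹) f - f), koopman_sub,
      koopman_koopman, inv_mul_cancel_right]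
  have hone : ∀ ε > 0, ∀ᶠ g in 𝓝 (1 : G), dist (koopman μ g f) f < ε := by
    intro ε hε
    let D := TopologicalSpace.denseSeq (Lp ℝ 2 μ)
    let S : ℕ → Set G := fun n => {g | ‖koopman μ g f - D n‖ ^ 2 < (ε / 2) ^ 2}
    have hS : ∀ n, MeasurableSet (S n) := fun n => measurableSet_lt (hdist _) measurable_const
    have hcover : (⋃ n, S n) = Set.univ := by
      refine Set.eq_univ_of_forall fun g => ?_
      obtain ⟨n, hn⟩ := (TopologicalSpace.denseRange_denseSeq (Lp ℝ 2 μ)).exists_dist_lt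
        (koopman μ g f) (half_pos hε)
      rw [dist_eq_norm] at hn
      exact Set.mem_iUnion.2 ⟨n, pow_lt_pow_left₀ hn (norm_nonneg _) two_ne_zero⟩
    have hpos : ∃ n, 0 < haar (S n) := by
      by_contra! h
      have h0 : haar (⋃ n, S n) = 0 := measure_iUnion_null fun n => le_antisymm (h n) bot_le
      rw [hcover] at h0
      exact (NeZero.ne haar) (Measure.measure_univ_eq_zero.1 h0)
    obtain ⟨n, hn⟩ := hpos
    have hnhds := Measure.div_mem_nhds_one_of_haar_pos haar (S n) (hS n) hn
    filter_upwards [hnhds] with g hg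
    obtain ⟨a, ha, b, hb, rfl⟩ := hg
    have ha' : dist (koopman μ a f) (D n) < ε / 2 := by
      rw [dist_eq_norm]; exact lt_of_pow_lt_pow_left₀ 2 (half_pos hε).le ha
    have hb' : dist (koopman μ b f) (D n) < ε / 2 := by
      rw [dist_eq_norm]; exact lt_of_pow_lt_pow_left₀ 2 (half_pos hε).le hb
    change dist (koopman μ (a / b) f) f < ε
    rw [div_eq_mul_inv, ← hdist']
    calc _ ≤ _ := dist_triangle_right _ _ (D n)
      _ < ε := by linarith
  rw [continuous_iff_continuousAt]
  intro h
  rw [ContinuousAt, Metric.tendsto_nhds]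
  intro ε hε
  have ht : Tendsto (fun g => g * h⁻¹) (𝓝 h) (𝓝 1) := by
    have : Continuous fun g : G => g * h⁻¹ := by fun_prop
    simpa using this.tendsto h
  filter_upwards [ht.eventually (hone ε hε)] with g hg
  rwa [hdist']

end Koopman

/-! ### Equivariance of conditional expectation onto a factor -/

section Factor

variable {G X Y : Type*} [Group G] [MeasurableSpace G] [mX : MeasurableSpace X]
  [mY : MeasurableSpace Y] [MulAction G X] [MeasurableSMul₂ G X] [MulAction G Y]
  [MeasurableSMul₂ G Y] {μ : Measure X} [IsProbabilityMeasure μ] [SMulInvariantMeasure G X μ]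
  {ν : Measure Y} {π : X → Y}

lemma IsFactorMap.comap_le (hπ : IsFactorMap G μ ν π) : mY.comap π ≤ mX :=
  hπ.measurePreserving.measurable.comap_le

lemma IsFactorMap.measurable_smul_comap (hπ : IsFactorMap G μ ν π) (g : G) :
    Measurable[mY.comap π, mY.comap π] (fun x : X => g • x) := by
  rintro _ ⟨B, hB, rfl⟩
  refine ⟨(fun y => g • y) ⁻¹' B, measurable_const_smul g hB, ?_⟩
  ext x
  simp [hπ.equivariant]

lemma IsFactorMap.condExp_smul (hπ : IsFactorMap G μ ν π) (g : G) {h : X → ℝ}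
    (hh : Integrable h μ) :
    μ[fun x => h (g • x) | mY.comap π] =ᵐ[μ] fun x => (μ[h | mY.comap π]) (g • x) := by
  have hmp := measurePreserving_smul g μ
  symm
  refine ae_eq_condExp_of_forall_setIntegral_eq hπ.comap_le
    (hmp.integrable_comp_of_integrable hh)
    (fun s _ _ => (hmp.integrable_comp_of_integrable integrable_condExp).integrableOn)
    (fun s hs _ => ?_)
    (stronglyMeasurable_condExp.comp_measurable
      (hπ.measurable_smul_comap g)).aestronglyMeasurable
  set s' : Set X := (fun x => g⁻¹ • x) ⁻¹' s with hs'
  have hs'm : MeasurableSet[mY.comap π] s' := hπ.measurable_smul_comap g⁻¹ hs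
  have hss : s = (fun x => g • x) ⁻¹' s' := by ext x; simp [hs']
  have hemb : MeasurableEmbedding (fun x : X => g • x) := measurableEmbedding_const_smul g
  rw [hss, hmp.setIntegral_preimage_emb hemb, hmp.setIntegral_preimage_emb hemb (fun x => h x),
    setIntegral_condExp hπ.comap_le hh hs'm]

lemma IsFactorMap.condInner_koopman (hπ : IsFactorMap G μ ν π) (g : G) (u w : Lp ℝ 2 μ) :
    ∀ᵐ x ∂μ, condInner (mY.comap π) μ (koopman μ g u) (koopman μ g w) x =
      condInner (mY.comap π) μ u w (g • x) :=
  (condInner_congr (coeFn_koopman g u) (coeFn_koopman g w)).trans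
    (hπ.condExp_smul g ((Lp.memLp u).integrable_mul (Lp.memLp w)))

end Factor

/-! ### Almost-periodic functions through nets in `L²` -/

section AlmostPeriodic

variable {G X Y : Type*} {m : MeasurableSpace X} [Group G] [MeasurableSpace G] [mX : MeasurableSpace X]
  [mY : MeasurableSpace Y] [MulAction G X] [MeasurableSMul₂ G X]
  {μ : Measure X} [IsProbabilityMeasure μ] [SMulInvariantMeasure G X μ]
  {ν : Measure Y} {π : X → Y} {Γ : Subgroup G}

/-- The inclusion of `L^∞` in `L²`. -/
def lpTopToL2 (ξ : Lp ℝ ∞ μ) : Lp ℝ 2 μ := ((Lp.memLp ξ).mono_exponent le_top).toLp ξ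

lemma coeFn_lpTopToL2 (ξ : Lp ℝ ∞ μ) : lpTopToL2 ξ =ᵐ[μ] ξ := MemLp.coeFn_toLp _

lemma exists_lpTop_norm_sub_sq_le (u : Lp ℝ 2 μ) {δ : ℝ} (hδ : 0 < δ) :
    ∃ ξ : Lp ℝ ∞ μ, ‖u - lpTopToL2 ξ‖ ^ 2 ≤ δ := by
  obtain ⟨φ, h1, h2⟩ := (Lp.memLp u).exists_simpleFunc_eLpNorm_sub_lt (by simp)
    (ε := ENNReal.ofReal (Real.sqrt δ)) (by simpa using hδ)
  have h3 : MemLp φ ∞ μ := φ.memLp_top μ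
  refine ⟨h3.toLp φ, ?_⟩
  have h4 : ‖u - lpTopToL2 (h3.toLp φ)‖ ≤ Real.sqrt δ := by
    rw [Lp.norm_def]
    refine ENNReal.toReal_le_of_le_ofReal (Real.sqrt_nonneg _) (le_of_eq_of_le ?_ h1.le)
    refine eLpNorm_congr_ae ?_
    filter_upwards [Lp.coeFn_sub u (lpTopToL2 (h3.toLp φ)), coeFn_lpTopToL2 (h3.toLp φ),
      h3.coeFn_toLp] with x e1 e2 e3
    rw [e1, Pi.sub_apply, Pi.sub_apply, e2, e3]
  calc _ ≤ Real.sqrt δ ^ 2 := pow_le_pow_left₀ (norm_nonneg _) h4 2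
    _ = δ := Real.sq_sqrt hδ.le

lemma fibreNorm_le_iff (u : Lp ℝ 2 μ) {h : X → ℝ} (hu : h =ᵐ[μ] u) {ε : ℝ} (hε : 0 ≤ ε) :
    ∀ᵐ x ∂μ, (fibreNorm μ π h x ≤ ε ↔ condSq (mY.comap π) u x ≤ ε ^ 2) := by
  have h1 : factorCondExp μ π (fun z => h z ^ 2) =ᵐ[μ] condSq (mY.comap π) u :=
    condExp_congr_ae (by filter_upwards [hu] with x hx; rw [hx, sq])
  filter_upwards [h1] with x hx
  rw [fibreNorm, hx, Real.sqrt_le_iff]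
  exact ⟨fun h => h.2, fun h => ⟨hε, h⟩⟩

lemma koopman_sub_lpTop_ae_eq (γ : G) (f : Lp ℝ 2 μ) (ξ : Lp ℝ ∞ μ) :
    (fun z => koopman μ γ f z - ξ z) =ᵐ[μ] (koopman μ γ f - lpTopToL2 ξ : Lp ℝ 2 μ) := by
  filter_upwards [Lp.coeFn_sub (koopman μ γ f) (lpTopToL2 ξ), coeFn_lpTopToL2 ξ] with x h1 h2
  rw [h1, Pi.sub_apply, h2]

variable (m) in
/-- Almost periodicity with the net taken in `L²` instead of `L^∞`, and with squared fibre norms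
regarded as functions on `X`. -/
def HasFibreNets (Γ : Subgroup G) (f : Lp ℝ 2 μ) : Prop :=
  ∀ ε : ℝ, 0 < ε → ∃ (Ξ : Finset (Lp ℝ 2 μ)) (B : Set X), MeasurableSet[m] B ∧ 1 - ε < μ.real B ∧
    ∀ γ ∈ Γ, ∀ᵐ x ∂μ, x ∈ B → ∃ ξ ∈ Ξ, condSq m (koopman μ γ f - ξ) x ≤ ε

lemma one_sub_le_measureReal_inter {A B : Set X} (hB : MeasurableSet B) :
    μ.real A - μ.real Bᶜ ≤ μ.real (A ∩ B) := by
  have h := measureReal_inter_add_sdiff (μ := μ) (s := A) hB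
  have h2 : μ.real (A \ B) ≤ μ.real Bᶜ := measureReal_mono fun x hx => hx.2
  linarith

/-- Finite nets in `L²` can be replaced by nets in `L^∞`, at the cost of a small part of the
factor. -/
theorem isAlmostPeriodic_iff (hπ : MeasurePreserving π μ ν) (f : Lp ℝ 2 μ) :
    IsAlmostPeriodic Γ μ ν π f ↔ HasFibreNets (mY.comap π) Γ f := by
  classical
  have hm : mY.comap π ≤ mX := hπ.measurable.comap_le
  constructor
  · intro hf ε hε
    have hε1 : 0 < min ε 1 := lt_min hε one_pos
    obtain ⟨Ξ, E, hE, hνE, h⟩ := hf (min ε 1) hε1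
    refine ⟨Ξ.image lpTopToL2, π ⁻¹' E, ⟨E, hE, rfl⟩, ?_, fun γ hγ => ?_⟩
    · rw [measureReal_def, hπ.measure_preimage hE.nullMeasurableSet, ← measureReal_def]
      linarith [min_le_left ε 1]
    · have h1 : ∀ ξ ∈ Ξ, ∀ᵐ x ∂μ, (fibreNorm μ π (fun z => koopman μ γ f z - ξ z) x ≤ min ε 1 ↔
          condSq (mY.comap π) (koopman μ γ f - lpTopToL2 ξ) x ≤ (min ε 1) ^ 2) := fun ξ _ =>
        fibreNorm_le_iff _ (koopman_sub_lpTop_ae_eq γ f ξ) hε1.le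
      filter_upwards [h γ hγ, (Finset.eventually_all Ξ).2 h1] with x hx hx' hxE
      obtain ⟨ξ, hξ, hle⟩ := hx hxE
      refine ⟨_, Finset.mem_image_of_mem _ hξ, ((hx' ξ hξ).1 hle).trans ?_⟩
      nlinarith [min_le_left ε 1, min_le_right ε 1]
  · intro hf ε hε
    set ε1 : ℝ := min (ε / 2) (ε ^ 2 / 4) with hε1def
    have hε1 : 0 < ε1 := lt_min (by positivity) (by positivity)
    obtain ⟨Ξ, B, hB, hμB, h⟩ := hf ε1 hε1
    set η : ℝ := ε / (2 * (Ξ.card + 1)) with hη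
    have hη0 : 0 < η := by positivity
    choose a ha using fun u : Lp ℝ 2 μ =>
      exists_lpTop_norm_sub_sq_le u (mul_pos hε1 hη0)
    let D : Lp ℝ 2 μ → Set X := fun ξ => {x | ε1 < condSq (mY.comap π) (ξ - lpTopToL2 (a ξ)) x}
    have hD : ∀ ξ, MeasurableSet[mY.comap π] (D ξ) := fun ξ =>
      (stronglyMeasurable_condSq (m := mY.comap π) _).measurable measurableSet_Ioi
    have hDμ : ∀ ξ, μ.real (D ξ) ≤ η := fun ξ =>
      (measureReal_lt_condSq_le hm _ hε1).trans
        (by rw [div_le_iff₀' hε1]; exact ha ξ)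
    have hDU : MeasurableSet[mY.comap π] (⋃ ξ ∈ Ξ, D ξ) :=
      MeasurableSet.biUnion Ξ.countable_toSet fun ξ _ => hD ξ
    obtain ⟨E, hE, hEeq⟩ := hB.inter hDU.compl
    refine ⟨Ξ.image a, E, hE, ?_, fun γ hγ => ?_⟩
    · rw [measureReal_def, ← hπ.measure_preimage hE.nullMeasurableSet, ← measureReal_def, hEeq]
      have h1 := one_sub_le_measureReal_inter (μ := μ) (hm _ hDU.compl) (A := B)
      rw [compl_compl] at h1
      have h2 : μ.real (⋃ ξ ∈ Ξ, D ξ) ≤ Ξ.card * η :=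
        (measureReal_biUnion_finset_le Ξ D).trans
          ((Finset.sum_le_card_nsmul Ξ _ η fun ξ _ => hDμ ξ).trans_eq (nsmul_eq_mul _ _))
      have h3 : Ξ.card * η ≤ ε / 2 - η := by
        have : (Ξ.card + 1) * η = ε / 2 := by rw [hη]; field_simp
        linarith
      linarith [min_le_left (ε / 2) (ε ^ 2 / 4)]
    · have h1 : ∀ ξ ∈ Ξ, ∀ᵐ x ∂μ,
          (fibreNorm μ π (fun z => koopman μ γ f z - a ξ z) x ≤ ε ↔
            condSq (mY.comap π) (koopman μ γ f - lpTopToL2 (a ξ)) x ≤ ε ^ 2) ∧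
          condSq (mY.comap π) (koopman μ γ f - ξ + (ξ - lpTopToL2 (a ξ))) x ≤
            2 * condSq (mY.comap π) (koopman μ γ f - ξ) x +
              2 * condSq (mY.comap π) (ξ - lpTopToL2 (a ξ)) x := fun ξ _ =>
        (fibreNorm_le_iff _ (koopman_sub_lpTop_ae_eq γ f (a ξ)) hε.le).and (condSq_add_le _ _)
      filter_upwards [h γ hγ, (Finset.eventually_all Ξ).2 h1] with x hx hx' hxE
      have hxB : x ∈ B ∩ (⋃ ξ ∈ Ξ, D ξ)ᶜ := by rw [← hEeq]; exact hxE
      obtain ⟨ξ, hξ, hle⟩ := hx hxB.1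
      refine ⟨_, Finset.mem_image_of_mem _ hξ, (hx' ξ hξ).1.2 ?_⟩
      have hxD : condSq (mY.comap π) (ξ - lpTopToL2 (a ξ)) x ≤ ε1 := by
        by_contra hcon
        exact hxB.2 (Set.mem_biUnion hξ (not_le.1 hcon))
      have h3 := (hx' ξ hξ).2
      rw [sub_add_sub_cancel] at h3
      linarith [min_le_right (ε / 2) (ε ^ 2 / 4)]

lemma HasFibreNets.add {f f' : Lp ℝ 2 μ} (hm : m ≤ mX) (hf : HasFibreNets m Γ f)
    (hf' : HasFibreNets m Γ f') : HasFibreNets m Γ (f + f') := by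
  classical
  intro ε hε
  obtain ⟨Ξ, B, hB, hμB, h⟩ := hf (ε / 4) (by positivity)
  obtain ⟨Ξ', B', hB', hμB', h'⟩ := hf' (ε / 4) (by positivity)
  refine ⟨Finset.image₂ (· + ·) Ξ Ξ', B ∩ B', hB.inter hB', ?_, fun γ hγ => ?_⟩
  · have h1 := one_sub_le_measureReal_inter (μ := μ) (hm _ hB') (A := B)
    have h2 := probReal_compl_eq_one_sub (μ := μ) (hm _ hB')
    linarith
  · have h1 : ∀ ξ ∈ Ξ, ∀ᵐ x ∂μ, ∀ ξ' ∈ Ξ', condSq m (koopman μ γ f - ξ + (koopman μ γ f' - ξ')) x ≤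
        2 * condSq m (koopman μ γ f - ξ) x + 2 * condSq m (koopman μ γ f' - ξ') x := fun ξ _ =>
      (Finset.eventually_all Ξ').2 fun ξ' _ => condSq_add_le _ _
    filter_upwards [h γ hγ, h' γ hγ, (Finset.eventually_all Ξ).2 h1] with x hx hx' hadd hxB
    obtain ⟨ξ, hξ, hle⟩ := hx hxB.1
    obtain ⟨ξ', hξ', hle'⟩ := hx' hxB.2
    refine ⟨_, Finset.mem_image₂_of_mem hξ hξ', ?_⟩
    have := hadd ξ hξ ξ' hξ'
    rw [koopman_add, add_sub_add_comm]
    linarith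

lemma HasFibreNets.smul {f : Lp ℝ 2 μ} (hf : HasFibreNets m Γ f) (c : ℝ) :
    HasFibreNets m Γ (c • f) := by
  classical
  intro ε hε
  set ε1 : ℝ := min ε (ε / (c ^ 2 + 1)) with hε1
  obtain ⟨Ξ, B, hB, hμB, h⟩ := hf ε1 (lt_min hε (by positivity))
  refine ⟨Ξ.image (c • ·), B, hB, by linarith [min_le_left ε (ε / (c ^ 2 + 1))], fun γ hγ => ?_⟩
  have h1 : ∀ ξ ∈ Ξ, ∀ᵐ x ∂μ, condSq m (c • (koopman μ γ f - ξ)) x =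
      c ^ 2 * condSq m (koopman μ γ f - ξ) x := fun ξ _ => condSq_smul _ _
  filter_upwards [h γ hγ, (Finset.eventually_all Ξ).2 h1] with x hx hsm hxB
  obtain ⟨ξ, hξ, hle⟩ := hx hxB
  refine ⟨_, Finset.mem_image_of_mem _ hξ, ?_⟩
  rw [koopman_smul, ← smul_sub, hsm ξ hξ]
  have h2 : condSq m (koopman μ γ f - ξ) x ≤ ε / (c ^ 2 + 1) := hle.trans (min_le_right _ _)
  calc _ ≤ c ^ 2 * (ε / (c ^ 2 + 1)) := mul_le_mul_of_nonneg_left h2 (sq_nonneg c)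
    _ ≤ (c ^ 2 + 1) * (ε / (c ^ 2 + 1)) := by
        refine mul_le_mul_of_nonneg_right (by linarith) (by positivity)
    _ = ε := by field_simp

lemma condSq_eq_zero_of_eq_zero_on {u : Lp ℝ 2 μ} {B : Set X} (hB : MeasurableSet[m] B)
    (h : ∀ᵐ x ∂μ, x ∈ B → u x = 0) : ∀ᵐ x ∂μ, x ∈ B → condSq m u x = 0 := by
  have h1 : ∀ᵐ x ∂μ, x ∈ B → u x = (0 : Lp ℝ 2 μ) x := by
    filter_upwards [h, Lp.coeFn_zero ℝ 2 μ] with x hx h0 hxB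
    rw [hx hxB, h0]; rfl
  filter_upwards [condSq_eq_of_eq_on hB h1, condSq_smul (m := m) 0 (0 : Lp ℝ 2 μ)] with x h2 h3 hxB
  rw [h2 hxB]
  simpa using h3

lemma hasFibreNets_zero : HasFibreNets m Γ (0 : Lp ℝ 2 μ) := fun ε hε => by
  refine ⟨{0}, Set.univ, MeasurableSet.univ, by simpa using hε, fun γ _ => ?_⟩
  have h := condSq_smul (m := m) 0 (0 : Lp ℝ 2 μ)
  filter_upwards [h] with x hx _
  refine ⟨0, Finset.mem_singleton_self _, ?_⟩
  have h0 : koopman μ γ (0 : Lp ℝ 2 μ) = 0 := by simpa using koopman_smul γ 0 (0 : Lp ℝ 2 μ)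
  rw [h0, sub_zero]
  rw [smul_zero] at hx
  rw [hx]; simpa using hε.le

/-- Restriction of `u ∈ L²` to a measurable set, extended by zero. -/
def indicatorL2 {B : Set X} (hB : MeasurableSet B) (u : Lp ℝ 2 μ) : Lp ℝ 2 μ :=
  ((Lp.memLp u).indicator hB).toLp (B.indicator u)

lemma coeFn_indicatorL2 {B : Set X} (hB : MeasurableSet B) (u : Lp ℝ 2 μ) :
    indicatorL2 hB u =ᵐ[μ] B.indicator u := MemLp.coeFn_toLp _

/-- Almost periodicity survives restriction to an invariantly measurable set: each translate of the
restricted function coincides, at each point of the factor, with a translate of the function or with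
zero, so that adding `0` to the net suffices. -/
lemma HasFibreNets.indicator {f : Lp ℝ 2 μ} (hm : m ≤ mX)
    (hsm : ∀ g : G, Measurable[m, m] fun x : X => g • x) (hf : HasFibreNets m Γ f) {B : Set X}
    (hB : MeasurableSet[m] B) : HasFibreNets m Γ (indicatorL2 (hm B hB) f) := by
  classical
  intro ε hε
  obtain ⟨Ξ, A, hA, hμA, h⟩ := hf ε hε
  refine ⟨insert 0 Ξ, A, hA, hμA, fun γ hγ => ?_⟩
  set B' : Set X := (fun x => γ • x) ⁻¹' B
  have hB' : MeasurableSet[m] B' := hsm γ hB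
  have hk : ∀ᵐ x ∂μ, koopman μ γ (indicatorL2 (hm B hB) f) x = B'.indicator (koopman μ γ f) x := by
    filter_upwards [coeFn_koopman γ (indicatorL2 (hm B hB) f), coeFn_koopman γ f,
      (measurePreserving_smul γ μ).quasiMeasurePreserving.ae (coeFn_indicatorL2 (hm B hB) f)]
      with x h1 h2 h3
    rw [h1, h3]
    by_cases hx : γ • x ∈ B
    · have hx' : x ∈ B' := hx
      rw [Set.indicator_of_mem hx, Set.indicator_of_mem hx', h2]
    · have hx' : x ∉ B' := hx
      rw [Set.indicator_of_notMem hx, Set.indicator_of_notMem hx']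
  have hout : ∀ᵐ x ∂μ, x ∈ B'ᶜ → condSq m (koopman μ γ (indicatorL2 (hm B hB) f) - 0) x = 0 := by
    refine condSq_eq_zero_of_eq_zero_on hB'.compl ?_
    filter_upwards [hk] with x h1 hx
    rw [sub_zero, h1, Set.indicator_of_notMem hx]
  have hin : ∀ ξ ∈ Ξ, ∀ᵐ x ∂μ, x ∈ B' → condSq m (koopman μ γ (indicatorL2 (hm B hB) f) - ξ) x =
      condSq m (koopman μ γ f - ξ) x := fun ξ _ => by
    refine condSq_eq_of_eq_on hB' ?_
    filter_upwards [hk, Lp.coeFn_sub (koopman μ γ (indicatorL2 (hm B hB) f)) ξ,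
      Lp.coeFn_sub (koopman μ γ f) ξ] with x h1 h2 h3 hx
    rw [h2, h3, Pi.sub_apply, Pi.sub_apply, h1, Set.indicator_of_mem hx]
  filter_upwards [h γ hγ, hout, (Finset.eventually_all Ξ).2 hin] with x hx ho hi hxA
  by_cases hxB : x ∈ B'
  · obtain ⟨ξ, hξ, hle⟩ := hx hxA
    exact ⟨ξ, Finset.mem_insert_of_mem hξ, by rwa [hi ξ hξ hxB]⟩
  · exact ⟨0, Finset.mem_insert_self _ _, by rw [ho hxB]; exact hε.le⟩

end AlmostPeriodic

/-! ### Weakly mixing functions are orthogonal to almost-periodic ones -/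

section Orthogonal

variable {G X Y : Type*} {m : MeasurableSpace X} [Group G] [TopologicalSpace G] [IsTopologicalGroup G] [T2Space G]
  [LocallyCompactSpace G] [SecondCountableTopology G] [MeasurableSpace G] [BorelSpace G]
  {haar : Measure G} [haar.IsHaarMeasure]
  [mX : MeasurableSpace X] [MeasurableSpace.CountablyGenerated X]
  [mY : MeasurableSpace Y] [MulAction G X] [MeasurableSMul₂ G X]
  {μ : Measure X} [IsProbabilityMeasure μ] [SMulInvariantMeasure G X μ]
  {ν : Measure Y} {π : X → Y} {Γ : Subgroup G} {Φ : ℕ → Set G}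

lemma mem_WM_iff {f : Lp ℝ 2 μ} : f ∈ WM haar Φ μ π ↔ ∀ φ : Lp ℝ ∞ μ,
    Tendsto (fun N => (haar.real (Φ N))⁻¹ *
      ∫ g in Φ N, condMix (mY.comap π) φ (koopman μ g f) ∂haar) atTop (𝓝 0) := by
  simp only [WM, Set.mem_ofPred_eq, sq_abs]
  rfl

lemma continuous_condMix_koopman (haar : Measure G) [haar.IsHaarMeasure]
    (hm : m ≤ mX) (φ : Lp ℝ ∞ μ) (f : Lp ℝ 2 μ) :
    Continuous fun g : G => condMix m φ (koopman μ g f) :=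
  (continuous_condMix hm φ).comp (continuous_koopman haar f)

lemma IsLeftFolner.real_pos (hΦ : IsLeftFolner haar Φ) (N : ℕ) : 0 < haar.real (Φ N) :=
  ENNReal.toReal_pos (hΦ.pos N).ne' (hΦ.isCompact N).measure_ne_top

/-- Vanishing of the averages produces translates by elements of the dense subgroup which are nearly
conditionally orthogonal to given functions. -/
lemma exists_mem_sum_condMix_lt (hm : mY.comap π ≤ mX) (hΓ : Dense (Γ : Set G))
    (hΦ : IsLeftFolner haar Φ) {h : Lp ℝ 2 μ} (hh : h ∈ WM haar Φ μ π) (Ξ : Finset (Lp ℝ ∞ μ))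
    {ρ : ℝ} (hρ : 0 < ρ) :
    ∃ γ ∈ Γ, ∑ ξ ∈ Ξ, condMix (mY.comap π) ξ (koopman μ γ h) < ρ := by
  by_contra! hcon
  have hc : ∀ ξ : Lp ℝ ∞ μ, Continuous fun g : G => condMix (mY.comap π) ξ (koopman μ g h) :=
    fun ξ => continuous_condMix_koopman haar hm ξ h
  have hcs : Continuous fun g : G => ∑ ξ ∈ Ξ, condMix (mY.comap π) ξ (koopman μ g h) :=
    continuous_finsetSum _ fun ξ _ => hc ξ
  have hall : ∀ g : G, ρ ≤ ∑ ξ ∈ Ξ, condMix (mY.comap π) ξ (koopman μ g h) := fun g => by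
    have hcl : IsClosed {g : G | ρ ≤ ∑ ξ ∈ Ξ, condMix (mY.comap π) ξ (koopman μ g h)} :=
      isClosed_le continuous_const hcs
    exact hcl.closure_subset_iff.2 (fun γ hγ => hcon γ hγ) (hΓ g)
  have hlim : Tendsto (fun N => (haar.real (Φ N))⁻¹ *
      ∫ g in Φ N, ∑ ξ ∈ Ξ, condMix (mY.comap π) ξ (koopman μ g h) ∂haar) atTop (𝓝 0) := by
    have h1 := tendsto_finsetSum Ξ fun ξ _ => mem_WM_iff.1 hh ξ
    simp only [Finset.sum_const_zero] at h1
    refine h1.congr fun N => ?_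
    rw [integral_finsetSum _ fun ξ _ =>
      (hc ξ).continuousOn.integrableOn_compact (hΦ.isCompact N), Finset.mul_sum]
  refine absurd (ge_of_tendsto' hlim fun N => ?_) (not_le.2 hρ)
  have hpos := hΦ.real_pos N
  rw [← div_eq_inv_mul, le_div_iff₀ hpos]
  exact setIntegral_ge_of_const_le_real (hΦ.isCompact N).measurableSet
    (hΦ.isCompact N).measure_ne_top (fun g _ => hall g)
    (hcs.continuousOn.integrableOn_compact (hΦ.isCompact N))

lemma condInner_eq_sub_add (u w : Lp ℝ 2 μ) (ξ : Lp ℝ ∞ μ) : ∀ᵐ x ∂μ, condInner m μ u w x =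
    condInner m μ (u - lpTopToL2 ξ : Lp ℝ 2 μ) w x + condInner m μ ξ w x := by
  have i1 : Integrable (fun x => (u - lpTopToL2 ξ : Lp ℝ 2 μ) x * w x) μ :=
    (Lp.memLp _).integrable_mul (Lp.memLp w)
  have i2 : Integrable (fun x => lpTopToL2 ξ x * w x) μ :=
    (Lp.memLp _).integrable_mul (Lp.memLp w)
  have e1 : (fun x => u x * w x) =ᵐ[μ]
      (fun x => (u - lpTopToL2 ξ : Lp ℝ 2 μ) x * w x) + fun x => lpTopToL2 ξ x * w x := by
    filter_upwards [Lp.coeFn_sub u (lpTopToL2 ξ)] with x hx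
    simp only [Pi.add_apply, hx, Pi.sub_apply]; ring
  have e2 : condInner m μ (lpTopToL2 ξ) w =ᵐ[μ] condInner m μ ξ w :=
    condInner_congr (coeFn_lpTopToL2 ξ) (ae_eq_refl _)
  filter_upwards [condExp_congr_ae (m := m) e1, condExp_add i1 i2 m, e2] with x h1 h2 h3
  rw [← h3]
  exact h1.trans h2

lemma abs_add_le_of_sq_le {a b s ε τ : ℝ} (hε : 0 < ε) (hτ : 0 < τ) (hs : 0 ≤ s)
    (ha : a ^ 2 ≤ ε ^ 2 * s) :
    |a + b| ≤ (τ / 2 + b ^ 2 * (1 / (2 * τ))) + (ε / 2 + s * (ε / 2)) := by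
  refine (abs_add_le _ _).trans ?_
  rw [add_comm]
  refine add_le_add ?_ ?_
  · have h1 : τ / 2 + b ^ 2 * (1 / (2 * τ)) - |b| = (|b| - τ) ^ 2 / (2 * τ) := by
      rw [← sq_abs b]; field_simp; ring
    have h2 : 0 ≤ (|b| - τ) ^ 2 / (2 * τ) := by positivity
    linarith
  · refine abs_le_of_sq_le_sq (ha.trans ?_) (by positivity)
    nlinarith [mul_nonneg (sq_nonneg ε) (sq_nonneg (1 - s))]

lemma abs_integral_mul_le_of_net (hm : m ≤ mX) {B : Set X}
    (hB : MeasurableSet[m] B) {u w : Lp ℝ 2 μ} {Ξ : Finset (Lp ℝ ∞ μ)} {ε τ : ℝ} (hε : 0 < ε)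
    (hτ : 0 < τ)
    (h : ∀ᵐ x ∂μ, x ∈ B → ∃ ξ ∈ Ξ, condSq m (u - lpTopToL2 ξ) x ≤ ε ^ 2) :
    |∫ x in B, u x * w x ∂μ| ≤ Ξ.card * τ / 2 + (∑ ξ ∈ Ξ, condMix m ξ w) / (2 * τ) +
      ε * (1 + ‖w‖ ^ 2) / 2 := by
  have huw : Integrable (fun x => u x * w x) μ := (Lp.memLp u).integrable_mul (Lp.memLp w)
  set F : X → ℝ := fun x => (∑ ξ ∈ Ξ, (τ / 2 + condInner m μ ξ w x ^ 2 * (1 / (2 * τ)))) +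
    (ε / 2 + condSq m w x * (ε / 2)) with hF
  have hFi : ∀ ξ : Lp ℝ ∞ μ, Integrable (fun x => τ / 2 + condInner m μ ξ w x ^ 2 * (1 / (2 * τ))) μ :=
    fun ξ => (integrable_const _).add ((integrable_sq_condInner hm ξ w).mul_const _)
  have hFi2 : Integrable (fun x => ε / 2 + condSq m w x * (ε / 2)) μ :=
    (integrable_const _).add ((integrable_condSq w).mul_const _)
  have hFint : Integrable F μ := (integrable_finsetSum _ fun ξ _ => hFi ξ).add hFi2
  have hFval : ∫ x, F x ∂μ = Ξ.card * τ / 2 + (∑ ξ ∈ Ξ, condMix m ξ w) / (2 * τ) +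
      ε * (1 + ‖w‖ ^ 2) / 2 := by
    have h1 : ∀ ξ : Lp ℝ ∞ μ, ∫ x, (τ / 2 + condInner m μ ξ w x ^ 2 * (1 / (2 * τ))) ∂μ =
        τ / 2 + condMix m ξ w * (1 / (2 * τ)) := fun ξ => by
      rw [integral_add (integrable_const _) ((integrable_sq_condInner hm ξ w).mul_const _),
        integral_mul_const]
      simp [condMix]
    have h2 : ∫ x, (ε / 2 + condSq m w x * (ε / 2)) ∂μ = ε / 2 + ‖w‖ ^ 2 * (ε / 2) := by
      rw [integral_add (integrable_const _) ((integrable_condSq w).mul_const _),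
        integral_mul_const, integral_condSq hm]
      simp
    rw [hF, integral_add (integrable_finsetSum _ fun ξ _ => hFi ξ) hFi2,
      integral_finsetSum _ fun ξ _ => hFi ξ, h2]
    simp only [h1, Finset.sum_add_distrib, ← Finset.sum_mul, Finset.sum_const, nsmul_eq_mul]
    ring
  have hF0 : 0 ≤ᵐ[μ] F := by
    filter_upwards [condSq_nonneg (m := m) w] with x hx
    have : (0 : ℝ) ≤ condSq m w x := hx
    simp only [hF, Pi.zero_apply]; positivity
  have hsub : ∀ ξ ∈ Ξ, ∀ᵐ x ∂μ, condInner m μ u w x =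
      condInner m μ (u - lpTopToL2 ξ : Lp ℝ 2 μ) w x + condInner m μ ξ w x ∧
      condInner m μ (u - lpTopToL2 ξ : Lp ℝ 2 μ) w x ^ 2 ≤
        condSq m (u - lpTopToL2 ξ) x * condSq m w x := fun ξ _ =>
    (condInner_eq_sub_add u w ξ).and (sq_condInner_le hm (Lp.memLp _) (Lp.memLp _))
  have hbound : ∀ᵐ x ∂μ, x ∈ B → |condInner m μ u w x| ≤ F x := by
    filter_upwards [h, (Finset.eventually_all Ξ).2 hsub, condSq_nonneg (m := m) w] with
      x hx hs hw hxB
    obtain ⟨ξ, hξ, hle⟩ := hx hxB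
    obtain ⟨e1, e2⟩ := hs ξ hξ
    rw [e1]
    refine (abs_add_le_of_sq_le hε hτ hw
      (e2.trans (mul_le_mul_of_nonneg_right hle hw))).trans ?_
    exact add_le_add_left (Finset.single_le_sum
      (f := fun ξ : Lp ℝ ∞ μ => τ / 2 + condInner m μ ξ w x ^ 2 * (1 / (2 * τ)))
      (fun ξ _ => by positivity) hξ) _
  rw [← setIntegral_condExp hm huw hB]
  calc |∫ x in B, condInner m μ u w x ∂μ| ≤ ∫ x in B, |condInner m μ u w x| ∂μ :=
        abs_integral_le_integral_abs
    _ ≤ ∫ x in B, F x ∂μ :=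
        setIntegral_mono_on_ae (integrable_condInner _ _).abs.integrableOn hFint.integrableOn
          (hm _ hB) hbound
    _ ≤ ∫ x, F x ∂μ := setIntegral_le_integral hFint hF0
    _ = _ := hFval

/-- An almost-periodic function is orthogonal to every weakly mixing one: translate both by some `γ`
in the dense subgroup for which the translate of the weakly mixing function is nearly conditionally
orthogonal to the finite net. -/
theorem inner_eq_zero_of_isAlmostPeriodic_of_mem_WM (hπ : MeasurePreserving π μ ν)
    [IsProbabilityMeasure ν]
    (hΓ : Dense (Γ : Set G)) (hΦ : IsLeftFolner haar Φ) {f h : Lp ℝ 2 μ}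
    (hf : IsAlmostPeriodic Γ μ ν π f) (hh : h ∈ WM haar Φ μ π) : inner ℝ f h = 0 := by
  have hm : mY.comap π ≤ mX := hπ.measurable.comap_le
  have hfh : Integrable (fun x => f x * h x) μ := (Lp.memLp f).integrable_mul (Lp.memLp h)
  have hinner : ∀ u w : Lp ℝ 2 μ, inner ℝ u w = ∫ x, u x * w x ∂μ := fun u w => by
    rw [L2.inner_def]
    simp [mul_comm]
  suffices hsuff : ∀ ρ > 0, |inner ℝ f h| ≤ ρ * 4 by
    refine abs_eq_zero.1 (le_antisymm (le_of_forall_pos_le_add fun ε hε => ?_) (abs_nonneg _))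
    have := hsuff (ε / 4) (by positivity)
    linarith
  intro ρ hρ
  obtain ⟨δ, hδ0, hδ⟩ := exists_pos_setLIntegral_lt_of_measure_lt (μ := μ)
    (f := fun x => ‖f x * h x‖ₑ) hfh.2.ne (ε := ENNReal.ofReal ρ) (by simpa using hρ)
  obtain ⟨δ', hδ'0, hδ'⟩ := ENNReal.lt_iff_exists_real_btwn.1 hδ0
  have hδ'pos : 0 < δ' := ENNReal.ofReal_pos.1 hδ'.1
  set ε : ℝ := min δ' (ρ / (1 + ‖h‖ ^ 2)) with hεdef
  have hε : 0 < ε := lt_min hδ'pos (by positivity)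
  obtain ⟨Ξ, E, hE, hνE, hnet⟩ := hf ε hε
  set τ : ℝ := ρ / (Ξ.card + 1) with hτdef
  have hτ : 0 < τ := by positivity
  obtain ⟨γ, hγ, hsum⟩ := exists_mem_sum_condMix_lt hm hΓ hΦ hh Ξ (mul_pos (mul_pos two_pos hτ) hρ)
  set B : Set X := π ⁻¹' E with hBdef
  have hB : MeasurableSet[mY.comap π] B := ⟨E, hE, rfl⟩
  have hnet' : ∀ᵐ x ∂μ, x ∈ B →
      ∃ ξ ∈ Ξ, condSq (mY.comap π) (koopman μ γ f - lpTopToL2 ξ) x ≤ ε ^ 2 := by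
    have h1 : ∀ ξ ∈ Ξ, ∀ᵐ x ∂μ, (fibreNorm μ π (fun z => koopman μ γ f z - ξ z) x ≤ ε ↔
        condSq (mY.comap π) (koopman μ γ f - lpTopToL2 ξ) x ≤ ε ^ 2) := fun ξ _ =>
      fibreNorm_le_iff _ (koopman_sub_lpTop_ae_eq γ f ξ) hε.le
    filter_upwards [hnet γ hγ, (Finset.eventually_all Ξ).2 h1] with x hx hx' hxE
    obtain ⟨ξ, hξ, hle⟩ := hx hxE
    exact ⟨ξ, hξ, (hx' ξ hξ).1 hle⟩
  have hin := abs_integral_mul_le_of_net hm hB (w := koopman μ γ h) hε hτ hnet'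
  rw [norm_koopman] at hin
  have hout : |∫ x in Bᶜ, koopman μ γ f x * koopman μ γ h x ∂μ| ≤ ρ := by
    set S : Set X := (fun x => γ⁻¹ • x) ⁻¹' Bᶜ with hS
    have hSm : MeasurableSet S := measurable_const_smul γ⁻¹ (hm _ hB).compl
    have hBS : Bᶜ = (fun x => γ • x) ⁻¹' S := by ext x; simp [hS]
    have hμS : μ S < δ := by
      rw [hS, (measurePreserving_smul γ⁻¹ μ).measure_preimage (hm _ hB).compl.nullMeasurableSet]
      refine lt_of_le_of_lt ?_ hδ'.2
      rw [← ofReal_measureReal, probReal_compl_eq_one_sub (hm _ hB)]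
      refine ENNReal.ofReal_le_ofReal ?_
      have : μ.real B = ν.real E := by
        rw [measureReal_def, hBdef, hπ.measure_preimage hE.nullMeasurableSet, ← measureReal_def]
      linarith [min_le_left δ' (ρ / (1 + ‖h‖ ^ 2))]
    have e1 : ∫ x in Bᶜ, koopman μ γ f x * koopman μ γ h x ∂μ = ∫ x in S, f x * h x ∂μ := by
      rw [hBS, ← (measurePreserving_smul γ μ).setIntegral_preimage_emb
        (measurableEmbedding_const_smul γ) (fun x => f x * h x)]
      refine integral_congr_ae (ae_restrict_of_ae ?_)
      filter_upwards [coeFn_koopman γ f, coeFn_koopman γ h] with x h1 h2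
      rw [h1, h2]
    rw [e1, ← Real.norm_eq_abs]
    refine (norm_integral_le_lintegral_norm _).trans ?_
    refine ENNReal.toReal_le_of_le_ofReal hρ.le ?_
    simp only [ofReal_norm]
    exact (hδ S hμS).le
  have huw : Integrable (fun x => koopman μ γ f x * koopman μ γ h x) μ :=
    (Lp.memLp _).integrable_mul (Lp.memLp _)
  rw [← inner_koopman γ, hinner, ← integral_add_compl (hm _ hB) huw]
  refine (abs_add_le _ _).trans ((add_le_add hin hout).trans ?_)
  have h1 : Ξ.card * τ ≤ ρ := by
    have : (Ξ.card + 1) * τ = ρ := by rw [hτdef]; field_simp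
    linarith
  have h2 : (∑ ξ ∈ Ξ, condMix (mY.comap π) ξ (koopman μ γ h)) / (2 * τ) ≤ ρ := by
    rw [div_le_iff₀' (by positivity)]; exact hsum.le
  have h3 : ε * (1 + ‖h‖ ^ 2) ≤ ρ := by
    rw [← le_div_iff₀ (by positivity)]; exact min_le_right _ _
  linarith

end Orthogonal

/-! ### An almost-periodic function correlating with a given one -/

section General

variable {G X : Type*} {m : MeasurableSpace X} [mX : MeasurableSpace X] {μ : Measure X}

/-- `hsOp` with values in `L²`. -/
def hsOpLp {v : G → X → ℝ} {w : X → ℝ} (h : ∀ c, MemLp (hsOp m μ v w c) 2 μ) :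
    (G →₀ ℝ) →ₗ[ℝ] Lp ℝ 2 μ where
  toFun c := (h c).toLp
  map_add' a b := by
    rw [← MemLp.toLp_add]
    exact MemLp.toLp_congr _ _ (by rw [map_add])
  map_smul' r a := by
    rw [RingHom.id_apply, ← MemLp.toLp_const_smul]
    exact MemLp.toLp_congr _ _ (by rw [map_smul])

lemma coeFn_hsOpLp {v : G → X → ℝ} {w : X → ℝ} (h : ∀ c, MemLp (hsOp m μ v w c) 2 μ)
    (c : G →₀ ℝ) : hsOpLp h c =ᵐ[μ] hsOp m μ v w c := MemLp.coeFn_toLp (h c)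

/-- The total weight of a finitely supported function. -/
def totalWeight (G : Type*) : (G →₀ ℝ) →ₗ[ℝ] ℝ := Finsupp.linearCombination ℝ fun _ => (1 : ℝ)

lemma totalWeight_single (g : G) : totalWeight G (Finsupp.single g 1) = 1 := by
  simp [totalWeight]

lemma totalWeight_mapDomain (φ : G → G) (c : G →₀ ℝ) :
    totalWeight G (c.mapDomain φ) = totalWeight G c := by
  simp only [totalWeight, Finsupp.linearCombination_mapDomain]; rfl

lemma kernelForm_mapDomain {κ : G → G → ℝ} {φ : G → G} (h : ∀ g g', κ (φ g) (φ g') = κ g g')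
    (c d : G →₀ ℝ) : kernelForm κ (c.mapDomain φ) (d.mapDomain φ) = kernelForm κ c d := by
  unfold kernelForm
  rw [Finsupp.linearCombination_mapDomain, Finsupp.linearCombination_apply,
    Finsupp.linearCombination_apply, Finsupp.sum, Finsupp.sum, LinearMap.sum_apply,
    LinearMap.sum_apply]
  refine Finset.sum_congr rfl fun g _ => ?_
  rw [LinearMap.smul_apply, LinearMap.smul_apply, Function.comp_apply,
    Finsupp.linearCombination_mapDomain]
  congr 3
  funext g'
  exact h g g'

/-- An almost everywhere bound by functions converging to zero in `L¹`. -/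
lemma ae_le_of_tendsto_integral {r : X → ℝ} {s : ℕ → X → ℝ} {B : Set X}
    (hs : ∀ j, Integrable (s j) μ) (hs0 : ∀ j, 0 ≤ᵐ[μ] s j)
    (hlim : Tendsto (fun j => ∫ x, s j x ∂μ) atTop (𝓝 0))
    (hr : ∀ᶠ j in atTop, ∀ᵐ x ∂μ, x ∈ B → r x ≤ s j x) : ∀ᵐ x ∂μ, x ∈ B → r x ≤ 0 := by
  have h1 : Tendsto (fun j => eLpNorm (s j - 0) 1 μ) atTop (𝓝 0) := by
    have h2 : ∀ j, eLpNorm (s j - 0) 1 μ = ENNReal.ofReal (∫ x, s j x ∂μ) := fun j => by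
      rw [sub_zero, eLpNorm_one_eq_lintegral_enorm, ← ofReal_integral_norm_eq_lintegral_enorm (hs j)]
      congr 1
      refine integral_congr_ae ?_
      filter_upwards [hs0 j] with x hx
      exact Real.norm_of_nonneg hx
    simp only [h2]
    simpa using ENNReal.tendsto_ofReal hlim
  obtain ⟨ns, hns, hae⟩ := (tendstoInMeasure_of_tendsto_eLpNorm one_ne_zero
    (fun j => (hs j).aestronglyMeasurable) aestronglyMeasurable_zero h1).exists_seq_tendsto_ae
  obtain ⟨N, hN⟩ := eventually_atTop.1 hr
  have hall : ∀ᵐ x ∂μ, ∀ j, N ≤ j → x ∈ B → r x ≤ s j x := by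
    rw [ae_all_iff]
    intro j
    by_cases hj : N ≤ j
    · filter_upwards [hN j hj] with x hx _ using hx
    · exact Eventually.of_forall fun x h => absurd h hj
  filter_upwards [hae, hall] with x hx hle hxB
  exact ge_of_tendsto hx ((hns.tendsto_atTop.eventually (eventually_ge_atTop N)).mono
    fun i hi => hle _ hi hxB)

variable [IsFiniteMeasure μ] {v : G → X → ℝ}

/-- If the increments of a sequence of weights are small at `x` for all indices `≥ n`, then the whole
tail stays close to the `n`-th term. -/
lemma ae_hsSq_tail_le (hm : m ≤ mX) (hv : ∀ g, MemLp (v g) 2 μ) (c : ℕ → G →₀ ℝ) :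
    ∀ᵐ x ∂μ, ∀ i n : ℕ, (∀ k, n ≤ k → hsSq m μ v (c (k + 1) - c k) x ≤ (1 / 4) ^ k) →
      hsSq m μ v (c (n + i) - c n) x ≤ 4 * (1 / 4) ^ n := by
  have h1 : ∀ᵐ x ∂μ, ∀ i n : ℕ, hsSq m μ v (c (n + 1) - c n + (c (n + 1 + i) - c (n + 1))) x ≤
      2 * hsSq m μ v (c (n + 1) - c n) x + 2 * hsSq m μ v (c (n + 1 + i) - c (n + 1)) x :=
    ae_all_iff.2 fun i => ae_all_iff.2 fun n => hsSq_add_le hm hv _ _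
  filter_upwards [h1] with x hx i
  induction i with
  | zero =>
    intro n _
    simp only [add_zero, sub_self, hsSq, map_zero]
    positivity
  | succ i ih =>
    intro n hn
    have h2 := ih (n + 1) fun k hk => hn k (by omega)
    have h3 := hx i n
    have h4 := hn n le_rfl
    have e : c (n + 1) - c n + (c (n + 1 + i) - c (n + 1)) = c (n + (i + 1)) - c n := by
      rw [add_assoc n 1 i, add_comm 1 i]; abel
    rw [e] at h3
    rw [pow_succ] at h2
    linarith

end General

section Net

variable {G X : Type*} {m : MeasurableSpace X} [mX : MeasurableSpace X] {μ : Measure X}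
  [IsFiniteMeasure μ] {v : G → Lp ℝ 2 μ} {C : ℝ}

lemma exists_finset_net_Icc (C : ℝ) {δ : ℝ} (hδ : 0 < δ) :
    ∃ A : Finset ℝ, ∀ t, |t| ≤ C → ∃ a ∈ A, |t - a| ≤ δ := by
  obtain ⟨A, -, hfin, hA⟩ := (isCompact_Icc (a := -C) (b := C)).finite_cover_balls hδ
  refine ⟨hfin.toFinset, fun t ht => ?_⟩
  obtain ⟨a, ha, hta⟩ := Set.mem_iUnion₂.1 (hA (abs_le.1 ht))
  exact ⟨a, hfin.mem_toFinset.2 ha, (Real.dist_eq t a ▸ (Metric.mem_ball.1 hta)).le⟩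

/-- A finite-rank operator with fixed weights maps functions with bounded fibre norms into a set with
finite fibrewise nets: its coefficients are bounded, so they can be rounded to a finite grid. -/
lemma exists_net_hsOpLp (hm : m ≤ mX) (hC0 : 0 ≤ C) (hC : ∀ g, ∀ᵐ x ∂μ, condSq m (v g) x ≤ C)
    (c : G →₀ ℝ) {ε : ℝ} (hε : 0 < ε) :
    ∃ Ξ : Finset (Lp ℝ 2 μ), ∀ (w : Lp ℝ 2 μ), (∀ᵐ x ∂μ, condSq m w x ≤ C) →
      ∀ (h : ∀ c, MemLp (hsOp m μ (fun g => v g) w c) 2 μ),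
      ∀ᵐ x ∂μ, ∃ ξ ∈ Ξ, condSq m (hsOpLp h c - ξ) x ≤ ε := by
  classical
  set S : ℝ := ∑ g ∈ c.support, |c g| with hS
  have hS0 : 0 ≤ S := Finset.sum_nonneg fun _ _ => abs_nonneg _
  set δ : ℝ := Real.sqrt (ε / (S ^ 2 * C + 1)) with hδdef
  have hδ2 : δ ^ 2 = ε / (S ^ 2 * C + 1) := Real.sq_sqrt (by positivity)
  obtain ⟨A, hA⟩ := exists_finset_net_Icc C (δ := δ) (Real.sqrt_pos.2 (by positivity))
  let ξ : (c.support → ℝ) → Lp ℝ 2 μ := fun a => ∑ g : c.support, (c g * a g) • v g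
  refine ⟨(Fintype.piFinset fun _ : c.support => A).image ξ, fun w hw h => ?_⟩
  have hk : ∀ g, ∀ᵐ x ∂μ, |condInner m μ (v g) w x| ≤ C := fun g =>
    ae_abs_condInner_le hm hC0 (Lp.memLp _) (Lp.memLp _) (hC g) hw
  have hvv : ∀ g g', ∀ᵐ x ∂μ, |condInner m μ (v g) (v g') x| ≤ C := fun g g' =>
    ae_abs_condInner_le hm hC0 (Lp.memLp _) (Lp.memLp _) (hC g) (hC g')
  have hsum : ∀ a : c.support → ℝ, ∀ᵐ x ∂μ, condSq m (hsOpLp h c - ξ a) x =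
      ∑ g : c.support, ∑ g' : c.support, (c g * (condInner m μ (v g) w x - a g)) *
        (c g' * (condInner m μ (v g') w x - a g')) * condInner m μ (v g) (v g') x := fun a => by
    have h1 := condInner_sum_sum (m := m) (μ := μ) hm (Finset.univ : Finset c.support)
      (p := fun g x => c g * (condInner m μ (v g) w x - a g)) (u := fun g => v g)
      (C := S * (C + ∑ g, |a g|))
      (fun g => stronglyMeasurable_const.mul
        ((stronglyMeasurable_condInner _ _).sub stronglyMeasurable_const))
      (fun g => by
        filter_upwards [hk g] with x hx
        rw [abs_mul]
        refine mul_le_mul (Finset.single_le_sum (f := fun g => |c g|) (fun _ _ => abs_nonneg _) g.2)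
          ((abs_sub _ _).trans (add_le_add hx
            (Finset.single_le_sum (f := fun g => |a g|) (fun _ _ => abs_nonneg _)
              (Finset.mem_univ g)))) (abs_nonneg _) hS0)
      (fun g => Lp.memLp _)
    have h2 : (hsOpLp h c - ξ a : Lp ℝ 2 μ) =ᵐ[μ]
        fun x => ∑ g : c.support, (c g * (condInner m μ (v g) w x - a g)) * v g x := by
      have h3 : ∀ g : c.support, ∀ᵐ x ∂μ, ((c g * a g) • v g : Lp ℝ 2 μ) x = c g * a g * v g x :=
        fun g => Lp.coeFn_smul _ _
      filter_upwards [Lp.coeFn_sub (hsOpLp h c) (ξ a), coeFn_hsOpLp h c,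
        Lp.coeFn_finsetSum (Finset.univ : Finset c.support) (fun g => (c g * a g) • v g),
        ae_all_iff.2 h3] with x e1 e2 e3 e4
      rw [e1, Pi.sub_apply, e2, hsOp_apply, e3, Finset.sum_apply, ← Finset.sum_coe_sort,
        ← Finset.sum_sub_distrib]
      refine Finset.sum_congr rfl fun g _ => ?_
      rw [e4]; ring
    exact (condInner_congr h2 h2).trans h1
  filter_upwards [ae_all_iff.2 fun g : c.support => hk g,
    ae_all_iff.2 fun g : c.support => ae_all_iff.2 fun g' : c.support => hvv g g',
    (Finset.eventually_all (Fintype.piFinset fun _ : c.support => A)).2 fun a _ => hsum a]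
    with x hkx hvx hx
  choose a haA ha using fun g : c.support => hA _ (hkx g)
  have hmem : a ∈ Fintype.piFinset fun _ : c.support => A := Fintype.mem_piFinset.2 haA
  refine ⟨ξ a, Finset.mem_image_of_mem _ hmem, ?_⟩
  rw [hx a hmem]
  have hterm : ∀ g g' : c.support, (c g * (condInner m μ (v g) w x - a g)) *
        (c g' * (condInner m μ (v g') w x - a g')) * condInner m μ (v g) (v g') x ≤
      |c g| * |c g'| * (δ ^ 2 * C) := fun g g' => by
    refine (le_abs_self _).trans ?_
    rw [abs_mul, abs_mul, abs_mul, abs_mul]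
    have hd0 : 0 ≤ δ := Real.sqrt_nonneg _
    have h1 := mul_le_mul (ha g) (ha g') (abs_nonneg _) hd0
    have h2 := mul_le_mul h1 (hvx g g') (abs_nonneg _) (mul_nonneg hd0 hd0)
    calc _ = |c g| * |c g'| * (|condInner m μ (v g) w x - a g| *
          |condInner m μ (v g') w x - a g'| * |condInner m μ (v g) (v g') x|) := by ring
      _ ≤ |c g| * |c g'| * (δ * δ * C) := mul_le_mul_of_nonneg_left h2 (by positivity)
      _ = _ := by ring
  calc _ ≤ ∑ g : c.support, ∑ g' : c.support, |c g| * |c g'| * (δ ^ 2 * C) :=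
        Finset.sum_le_sum fun g _ => Finset.sum_le_sum fun g' _ => hterm g g'
    _ = S ^ 2 * C * δ ^ 2 := by
        have e : S = ∑ g : c.support, |c g| := by rw [hS, ← Finset.sum_coe_sort]
        simp only [← Finset.sum_mul, ← Finset.mul_sum]
        rw [← e]; ring
    _ ≤ (S ^ 2 * C + 1) * δ ^ 2 := mul_le_mul_of_nonneg_right (by linarith) (sq_nonneg _)
    _ = ε := by rw [hδ2]; field_simp

end Net

section Tail

variable {G X : Type*} {m : MeasurableSpace X} [mX : MeasurableSpace X] {μ : Measure X}
  [IsProbabilityMeasure μ] {v : G → X → ℝ} {C : ℝ}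

/-- The set where all increments with index `≥ n` are small is large. -/
lemma measureReal_forall_hsSq_ge (hm : m ≤ mX) (hv : ∀ g, MemLp (v g) 2 μ) (hC0 : 0 ≤ C)
    (hC : ∀ g, ∀ᵐ x ∂μ, condInner m μ (v g) (v g) x ≤ C) {b : ℕ → G →₀ ℝ}
    (hb : ∀ k, hsForm m μ v (b k) (b k) ≤ (1 / 8) ^ k) (n : ℕ) :
    MeasurableSet[m] {x | ∀ k, n ≤ k → hsSq m μ v (b k) x ≤ (1 / 4) ^ k} ∧
    1 - 2 * (1 / 2) ^ n ≤ μ.real {x | ∀ k, n ≤ k → hsSq m μ v (b k) x ≤ (1 / 4) ^ k} := by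
  have hmeas : ∀ k, MeasurableSet[m] {x | (1 / 4 : ℝ) ^ k < hsSq m μ v (b k) x} := fun k =>
    (stronglyMeasurable_hsSq (m := m) (b k)).measurable measurableSet_Ioi
  have hcompl : {x | ∀ k, n ≤ k → hsSq m μ v (b k) x ≤ (1 / 4) ^ k} =
      (⋃ i, {x | (1 / 4 : ℝ) ^ (n + i) < hsSq m μ v (b (n + i)) x})ᶜ := by
    ext x
    simp only [Set.mem_ofPred_eq, Set.mem_compl_iff, Set.mem_iUnion, not_exists, not_lt]
    refine ⟨fun h i => h _ (Nat.le_add_right _ _), fun h k hk => ?_⟩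
    obtain ⟨i, rfl⟩ := Nat.exists_eq_add_of_le hk
    exact h i
  have hU : MeasurableSet[m] (⋃ i, {x | (1 / 4 : ℝ) ^ (n + i) < hsSq m μ v (b (n + i)) x}) :=
    MeasurableSet.iUnion fun i => hmeas _
  rw [hcompl]
  refine ⟨hU.compl, ?_⟩
  rw [probReal_compl_eq_one_sub (hm _ hU)]
  have hone : ∀ k, μ.real {x | (1 / 4 : ℝ) ^ k < hsSq m μ v (b k) x} ≤ (1 / 2) ^ k := fun k => by
    have h4 : (0 : ℝ) < (1 / 4) ^ k := by positivity
    have h1 : (1 / 4 : ℝ) ^ k * μ.real {x | (1 / 4 : ℝ) ^ k < hsSq m μ v (b k) x} ≤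
        (1 / 4) ^ k * (1 / 2) ^ k := by
      calc _ ≤ (1 / 4 : ℝ) ^ k * μ.real {x | (1 / 4 : ℝ) ^ k ≤ hsSq m μ v (b k) x} :=
            mul_le_mul_of_nonneg_left
              (measureReal_mono fun x (hx : (1 / 4 : ℝ) ^ k < _) => hx.le) h4.le
        _ ≤ ∫ x, hsSq m μ v (b k) x ∂μ := mul_meas_ge_le_integral_of_nonneg
            (hsSq_nonneg hm hv _) (integrable_hsSq hm hv hC0 hC _) _
        _ ≤ (1 / 8) ^ k := by rw [integral_hsSq hm hv hC0 hC]; exact hb k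
        _ = _ := by rw [← mul_pow]; norm_num
    exact le_of_mul_le_mul_left h1 h4
  have hsum : μ.real (⋃ i, {x | (1 / 4 : ℝ) ^ (n + i) < hsSq m μ v (b (n + i)) x}) ≤
      2 * (1 / 2) ^ n := by
    have hgeo : HasSum (fun i : ℕ => (1 / 2 : ℝ) ^ (n + i)) (2 * (1 / 2) ^ n) := by
      simp only [pow_add]
      rw [mul_comm 2]
      exact hasSum_geometric_two.mul_left _
    refine ENNReal.toReal_le_of_le_ofReal (by positivity) ((measure_iUnion_le _).trans ?_)
    rw [← hgeo.tsum_eq, ENNReal.ofReal_tsum_of_nonneg (fun i => by positivity) hgeo.summable]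
    refine ENNReal.tsum_le_tsum fun i => ?_
    rw [← ofReal_measureReal]
    exact ENNReal.ofReal_le_ofReal (hone _)
  linarith

end Tail

section Correlation

variable {G X Y : Type*} [Group G] [MeasurableSpace G] [mX : MeasurableSpace X]
  [mY : MeasurableSpace Y] [MulAction G X] [MeasurableSMul₂ G X] [MulAction G Y]
  [MeasurableSMul₂ G Y] {μ : Measure X} [IsProbabilityMeasure μ] [SMulInvariantMeasure G X μ]
  {ν : Measure Y} {π : X → Y} {f : Lp ℝ 2 μ} {C : ℝ}

variable (G) in
/-- The orbit of `f` under the Koopman representation, as a family of functions on `X`. -/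
def orbitFn (f : Lp ℝ 2 μ) (g : G) : X → ℝ := koopman μ g f

lemma memLp_orbitFn (f : Lp ℝ 2 μ) (g : G) : MemLp (orbitFn G f g) 2 μ := Lp.memLp _

lemma koopman_one (f : Lp ℝ 2 μ) : koopman μ (1 : G) f = f := by
  refine Lp.ext ?_
  filter_upwards [coeFn_koopman (1 : G) f] with x hx
  rw [hx, one_smul]

lemma IsFactorMap.condSq_koopman (hπ : IsFactorMap G μ ν π) (g : G) (u : Lp ℝ 2 μ) :
    ∀ᵐ x ∂μ, condSq (mY.comap π) (koopman μ g u) x = condSq (mY.comap π) u (g • x) :=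
  hπ.condInner_koopman g u u

lemma IsFactorMap.condSq_koopman_le (hπ : IsFactorMap G μ ν π)
    (hC : ∀ᵐ x ∂μ, condSq (mY.comap π) f x ≤ C) (g : G) :
    ∀ᵐ x ∂μ, condSq (mY.comap π) (koopman μ g f) x ≤ C := by
  filter_upwards [hπ.condSq_koopman g f,
    (measurePreserving_smul g μ).quasiMeasurePreserving.ae hC] with x h1 h2
  rwa [h1]

lemma IsFactorMap.memLp_hsOp_orbitFn (hπ : IsFactorMap G μ ν π) (hC0 : 0 ≤ C)
    (hC : ∀ᵐ x ∂μ, condSq (mY.comap π) f x ≤ C) (γ : G) (c : G →₀ ℝ) :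
    MemLp (hsOp (mY.comap π) μ (orbitFn G f) (orbitFn G f γ) c) 2 μ :=
  memLp_hsOp hπ.comap_le (memLp_orbitFn f) hC0 (hπ.condSq_koopman_le hC) (memLp_orbitFn f γ)
    (hπ.condSq_koopman_le hC γ) c

/-- Translating the finite-rank operator applied to `f` gives the operator with translated weights,
applied to the translate of `f`. -/
lemma IsFactorMap.koopman_hsOpLp (hπ : IsFactorMap G μ ν π) (hC0 : 0 ≤ C)
    (hC : ∀ᵐ x ∂μ, condSq (mY.comap π) f x ≤ C) (γ : G) (c : G →₀ ℝ) :
    koopman μ γ (hsOpLp (hπ.memLp_hsOp_orbitFn hC0 hC 1) c) =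
      hsOpLp (hπ.memLp_hsOp_orbitFn hC0 hC γ) (c.mapDomain (· * γ)) := by
  refine Lp.ext ?_
  have h1 : ∀ g ∈ c.support, ∀ᵐ x ∂μ,
      condInner (mY.comap π) μ (orbitFn G f (g * γ)) (orbitFn G f γ) x =
        condInner (mY.comap π) μ (orbitFn G f g) (orbitFn G f 1) (γ • x) ∧
      orbitFn G f (g * γ) x = orbitFn G f g (γ • x) := fun g _ => by
    have h2 := hπ.condInner_koopman γ (koopman μ g f) (koopman μ (1 : G) f)
    have h3 := coeFn_koopman γ (koopman μ g f)
    rw [koopman_koopman, koopman_koopman, one_mul] at h2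
    rw [koopman_koopman] at h3
    exact h2.and h3
  filter_upwards [coeFn_koopman γ (hsOpLp (hπ.memLp_hsOp_orbitFn hC0 hC 1) c),
    coeFn_hsOpLp (hπ.memLp_hsOp_orbitFn hC0 hC γ) (c.mapDomain (· * γ)),
    (measurePreserving_smul γ μ).quasiMeasurePreserving.ae
      (coeFn_hsOpLp (hπ.memLp_hsOp_orbitFn hC0 hC 1) c),
    (Finset.eventually_all c.support).2 h1] with x e1 e2 e3 e4
  rw [e1, e2, e3, hsOp_apply, hsOp, Finsupp.linearCombination_mapDomain,
    Finsupp.linearCombination_apply, Finsupp.sum, Finset.sum_apply]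
  refine Finset.sum_congr rfl fun g hg => ?_
  obtain ⟨e5, e6⟩ := e4 g hg
  simp only [Pi.smul_apply, Function.comp_apply, e5, e6, smul_eq_mul, mul_assoc]

lemma IsFactorMap.hsForm_mapDomain (hπ : IsFactorMap G μ ν π) (f : Lp ℝ 2 μ) (γ : G)
    (c d : G →₀ ℝ) :
    hsForm (mY.comap π) μ (orbitFn G f) (c.mapDomain (· * γ)) (d.mapDomain (· * γ)) =
      hsForm (mY.comap π) μ (orbitFn G f) c d := by
  refine kernelForm_mapDomain (fun g h => ?_) c d
  rw [← (measurePreserving_smul γ μ).integral_comp (measurableEmbedding_const_smul γ)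
    (fun x => condInner (mY.comap π) μ (orbitFn G f g) (orbitFn G f h) x ^ 2)]
  refine integral_congr_ae ?_
  have h2 := hπ.condInner_koopman γ (koopman μ g f) (koopman μ h f)
  rw [koopman_koopman, koopman_koopman] at h2
  filter_upwards [h2] with x hx
  exact congrArg (· ^ 2) hx

lemma IsFactorMap.inner_hsOpLp (hπ : IsFactorMap G μ ν π) (hC0 : 0 ≤ C)
    (hC : ∀ᵐ x ∂μ, condSq (mY.comap π) f x ≤ C) (c : G →₀ ℝ) :
    inner ℝ (hsOpLp (hπ.memLp_hsOp_orbitFn hC0 hC 1) c) f =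
      hsForm (mY.comap π) μ (orbitFn G f) c (Finsupp.single 1 1) := by
  have hm := hπ.comap_le
  set k : G → X → ℝ := fun g => condInner (mY.comap π) μ (orbitFn G f g) (orbitFn G f 1) with hk
  have hvv : ∀ g, Integrable (fun x => orbitFn G f g x * orbitFn G f 1 x) μ := fun g =>
    (memLp_orbitFn f g).integrable_mul (memLp_orbitFn f 1)
  have hkC : ∀ g, ∀ᵐ x ∂μ, ‖k g x‖ ≤ C := fun g =>
    ae_abs_condInner_le hm hC0 (memLp_orbitFn f g) (memLp_orbitFn f 1)
      (hπ.condSq_koopman_le hC g) (hπ.condSq_koopman_le hC 1)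
  have hkm : ∀ g, StronglyMeasurable[mY.comap π] (k g) := fun g => stronglyMeasurable_condInner _ _
  have hterm : ∀ g, ∫ x, k g x * (orbitFn G f g x * orbitFn G f 1 x) ∂μ = ∫ x, k g x ^ 2 ∂μ :=
    fun g => by
    rw [← integral_condExp hm]
    refine integral_congr_ae ?_
    filter_upwards [condExp_stronglyMeasurable_mul_of_bound hm (hkm g) (hvv g) C (hkC g)]
      with x hx
    rw [sq]; exact hx
  have hint : ∀ g, Integrable (fun x => k g x * (orbitFn G f g x * orbitFn G f 1 x)) μ := fun g =>
    (hvv g).bdd_mul ((hkm g).mono hm).aestronglyMeasurable (hkC g)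
  rw [L2.inner_def]
  have e : ∀ᵐ x ∂μ, inner ℝ (hsOpLp (hπ.memLp_hsOp_orbitFn hC0 hC 1) c x) (f x) =
      ∑ g ∈ c.support, c g * (k g x * (orbitFn G f g x * orbitFn G f 1 x)) := by
    filter_upwards [coeFn_hsOpLp (hπ.memLp_hsOp_orbitFn hC0 hC 1) c] with x hx
    have h1 : orbitFn G f 1 x = f x := by rw [orbitFn, koopman_one]
    have hin : ∀ a b : ℝ, inner ℝ a b = a * b := fun a b => by simp [mul_comm]
    rw [hx, hsOp_apply, hin, Finset.sum_mul]
    refine Finset.sum_congr rfl fun g _ => ?_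
    rw [← h1]; ring
  rw [integral_congr_ae e, integral_finsetSum _ fun g _ => (hint g).const_mul _]
  simp only [integral_const_mul, hterm]
  simp [hsForm, kernelForm, Finsupp.linearCombination_apply, Finsupp.sum, hk]

lemma IsFactorMap.norm_hsOpLp_sq_le (hπ : IsFactorMap G μ ν π) (hC0 : 0 ≤ C)
    (hC : ∀ᵐ x ∂μ, condSq (mY.comap π) f x ≤ C) (γ : G) (c : G →₀ ℝ) :
    (∀ᵐ x ∂μ, condSq (mY.comap π) (hsOpLp (hπ.memLp_hsOp_orbitFn hC0 hC γ) c) x ≤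
      C * hsSq (mY.comap π) μ (orbitFn G f) c x) ∧
    ‖hsOpLp (hπ.memLp_hsOp_orbitFn hC0 hC γ) c‖ ^ 2 ≤
      C * hsForm (mY.comap π) μ (orbitFn G f) c c := by
  have hm := hπ.comap_le
  have h1 : ∀ᵐ x ∂μ, condSq (mY.comap π) (hsOpLp (hπ.memLp_hsOp_orbitFn hC0 hC γ) c) x ≤
      C * hsSq (mY.comap π) μ (orbitFn G f) c x := by
    have e := coeFn_hsOpLp (hπ.memLp_hsOp_orbitFn hC0 hC γ) c
    filter_upwards [condInner_hsOp_le hm (memLp_orbitFn f) hC0 (hπ.condSq_koopman_le hC)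
      (memLp_orbitFn f γ) (hπ.condSq_koopman_le hC γ) c,
      condInner_congr (m := mY.comap π) e e] with x h1 h2
    rw [condSq, h2]; exact h1
  refine ⟨h1, ?_⟩
  rw [← integral_condSq hm, ← integral_hsSq hm (memLp_orbitFn f) hC0 (hπ.condSq_koopman_le hC),
    ← integral_const_mul]
  exact integral_mono_ae (integrable_condSq _) ((integrable_hsSq hm (memLp_orbitFn f) hC0
    (hπ.condSq_koopman_le hC) c).const_mul C) h1

end Correlation

section Key

variable {G X Y : Type*} [Group G] [MeasurableSpace G] [mX : MeasurableSpace X]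
  [mY : MeasurableSpace Y] [MulAction G X] [MeasurableSMul₂ G X] [MulAction G Y]
  [MeasurableSMul₂ G Y] {μ : Measure X} [IsProbabilityMeasure μ] [SMulInvariantMeasure G X μ]
  {ν : Measure Y} {π : X → Y} {f : Lp ℝ 2 μ} {C : ℝ}

/-- For a minimising sequence of weights, the limit of the finite-rank operators applied to `f`, when
translated, stays uniformly close on a large part of the factor to the `n`-th operator applied to the
translate of `f`. The exceptional set does not depend on the translation. -/
lemma IsFactorMap.condSq_koopman_sub_le (hπ : IsFactorMap G μ ν π) (hC0 : 0 ≤ C)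
    (hC : ∀ᵐ x ∂μ, condSq (mY.comap π) f x ≤ C) {c : ℕ → G →₀ ℝ} {F : Lp ℝ 2 μ}
    (hF : Tendsto (fun n => hsOpLp (hπ.memLp_hsOp_orbitFn hC0 hC 1) (c n)) atTop (𝓝 F)) (γ : G)
    (hγ : Tendsto (fun j => hsForm (mY.comap π) μ (orbitFn G f) ((c j).mapDomain (· * γ) - c j)
      ((c j).mapDomain (· * γ) - c j)) atTop (𝓝 0)) (n : ℕ) :
    ∀ᵐ x ∂μ, x ∈ {x | ∀ k, n ≤ k →
        hsSq (mY.comap π) μ (orbitFn G f) (c (k + 1) - c k) x ≤ (1 / 4) ^ k} →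
      condSq (mY.comap π) (koopman μ γ F - hsOpLp (hπ.memLp_hsOp_orbitFn hC0 hC γ) (c n)) x -
        16 * C * (1 / 4) ^ n ≤ 0 := by
  have hm := hπ.comap_le
  set T := fun γ => hsOpLp (hπ.memLp_hsOp_orbitFn hC0 hC γ) with hT
  set b : ℕ → G →₀ ℝ := fun j => (c j).mapDomain (· * γ) - c j with hb
  have hsplit : ∀ j, koopman μ γ F - T γ (c n) =
      koopman μ γ (F - T 1 (c j)) + (T γ (b j) + T γ (c j - c n)) := fun j => by
    rw [koopman_sub, hπ.koopman_hsOpLp hC0 hC γ (c j), hb]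
    simp only [map_sub, hT]
    abel
  have hi1 : ∀ j, Integrable (condSq (mY.comap π) (koopman μ γ (F - T 1 (c j)))) μ := fun j =>
    integrable_condSq _
  have hi2 : ∀ j, Integrable (hsSq (mY.comap π) μ (orbitFn G f) (b j)) μ := fun j =>
    integrable_hsSq hm (memLp_orbitFn f) hC0 (hπ.condSq_koopman_le hC) _
  refine ae_le_of_tendsto_integral (s := fun j x =>
      2 * condSq (mY.comap π) (koopman μ γ (F - T 1 (c j))) x +
        4 * C * hsSq (mY.comap π) μ (orbitFn G f) (b j) x)
    (fun j => ((hi1 j).const_mul 2).add ((hi2 j).const_mul _)) (fun j => ?_) ?_ ?_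
  · filter_upwards [condSq_nonneg (m := mY.comap π) (koopman μ γ (F - T 1 (c j))),
      hsSq_nonneg hm (memLp_orbitFn f) (b j)] with x h1 h2
    have h1' : (0 : ℝ) ≤ condSq (mY.comap π) (koopman μ γ (F - T 1 (c j))) x := h1
    simp only [Pi.zero_apply]
    positivity
  · have h1 : ∀ j, ∫ x, (2 * condSq (mY.comap π) (koopman μ γ (F - T 1 (c j))) x +
        4 * C * hsSq (mY.comap π) μ (orbitFn G f) (b j) x) ∂μ =
        2 * ‖T 1 (c j) - F‖ ^ 2 + 4 * C * hsForm (mY.comap π) μ (orbitFn G f) (b j) (b j) :=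
      fun j => by
      rw [integral_add ((hi1 j).const_mul 2) ((hi2 j).const_mul _), integral_const_mul,
        integral_const_mul, integral_condSq hm, norm_koopman, norm_sub_rev,
        integral_hsSq hm (memLp_orbitFn f) hC0 (hπ.condSq_koopman_le hC)]
    simp only [h1]
    have h2 : Tendsto (fun j => ‖T 1 (c j) - F‖) atTop (𝓝 0) :=
      tendsto_iff_norm_sub_tendsto_zero.1 hF
    have h3 := ((h2.pow 2).const_mul 2).add (hγ.const_mul (4 * C))
    rwa [zero_pow two_ne_zero, mul_zero, mul_zero, add_zero] at h3
  · filter_upwards [eventually_ge_atTop n] with j hj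
    obtain ⟨i, rfl⟩ := Nat.exists_eq_add_of_le hj
    filter_upwards [condSq_add_le (m := mY.comap π) (koopman μ γ (F - T 1 (c (n + i))))
        (T γ (b (n + i)) + T γ (c (n + i) - c n)),
      condSq_add_le (m := mY.comap π) (T γ (b (n + i))) (T γ (c (n + i) - c n)),
      (hπ.norm_hsOpLp_sq_le hC0 hC γ (b (n + i))).1,
      (hπ.norm_hsOpLp_sq_le hC0 hC γ (c (n + i) - c n)).1,
      ae_hsSq_tail_le hm (memLp_orbitFn f) c] with x h1 h2 h3 h4 h5 hx
    have h6 := mul_le_mul_of_nonneg_left (h5 i n hx) hC0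
    rw [hsplit (n + i)]
    linarith

/-- If `f`, with bounded fibre norms, is orthogonal to all almost-periodic functions, then signed
averages of total weight one of the rank-one operators attached to its translates can be made small
in conditional Hilbert–Schmidt norm. Otherwise these averages have a nonzero element of minimal norm;
it commutes with the action, and its value at `f` is an almost-periodic function whose inner product
with `f` is the square of the minimal norm. -/
theorem IsFactorMap.exists_hsForm_lt (hπ : IsFactorMap G μ ν π) (Γ : Subgroup G) (hC0 : 0 ≤ C)
    (hC : ∀ᵐ x ∂μ, condSq (mY.comap π) f x ≤ C)
    (hperp : ∀ F : Lp ℝ 2 μ, HasFibreNets (mY.comap π) Γ F → inner ℝ F f = 0) {η : ℝ}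
    (hη : 0 < η) :
    ∃ c : G →₀ ℝ, totalWeight G c = 1 ∧ hsForm (mY.comap π) μ (orbitFn G f) c c < η := by
  have hm := hπ.comap_le
  set B := hsForm (mY.comap π) μ (orbitFn G f) with hB
  set T := fun γ => hsOpLp (hπ.memLp_hsOp_orbitFn hC0 hC γ) with hT
  have hB0 : ∀ c, 0 ≤ B c c := hsForm_self_nonneg hm (memLp_orbitFn f) hC0 (hπ.condSq_koopman_le hC)
  obtain ⟨d, hd0, hd, c, hc⟩ := exists_minimizing_seq hB0 (totalWeight_single (1 : G))
  have hinc : ∀ k, B (c (k + 1) - c k) (c (k + 1) - c k) ≤ (1 / 8) ^ k := fun k => by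
    have h := form_sub_le_of_near_min hd (hc (k + 1)).1 (hc k).1 (hc (k + 1)).2 (hc k).2
    have h8 : (0 : ℝ) < (1 / 8) ^ k := by positivity
    rw [pow_succ] at h
    linarith
  have htrans : ∀ γ : G, Tendsto (fun j => B ((c j).mapDomain (· * γ) - c j)
      ((c j).mapDomain (· * γ) - c j)) atTop (𝓝 0) := fun γ => by
    have h8 : Tendsto (fun j : ℕ => (1 / 8 : ℝ) ^ j) atTop (𝓝 0) :=
      tendsto_pow_atTop_nhds_zero_of_lt_one (by norm_num) (by norm_num)
    refine squeeze_zero (fun j => hB0 _) (fun j => ?_) h8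
    have h := form_sub_le_of_near_min hd ((totalWeight_mapDomain (· * γ) (c j)).trans (hc j).1)
      (hc j).1 ((hπ.hsForm_mapDomain f γ (c j) (c j)).trans_le (hc j).2) (hc j).2
    linarith
  have hcauchy : CauchySeq fun n => T 1 (c n) := by
    refine cauchySeq_of_le_geometric (1 / 2) (Real.sqrt C) (by norm_num) fun n => ?_
    rw [dist_comm, dist_eq_norm, ← map_sub]
    refine le_of_sq_le_sq ?_ (by positivity)
    refine ((hπ.norm_hsOpLp_sq_le hC0 hC 1 (c (n + 1) - c n)).2.trans
      (mul_le_mul_of_nonneg_left (hinc n) hC0)).trans ?_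
    rw [mul_pow, Real.sq_sqrt hC0, ← pow_mul, mul_comm n 2, pow_mul]
    exact mul_le_mul_of_nonneg_left
      (pow_le_pow_left₀ (by norm_num) (by norm_num) n) hC0
  obtain ⟨F, hF⟩ := cauchySeq_tendsto_of_complete hcauchy
  have hnets : HasFibreNets (mY.comap π) Γ F := by
    intro ε hε
    have hsmall : ∀ᶠ n : ℕ in atTop, 2 * (1 / 2 : ℝ) ^ n < ε ∧ 16 * C * (1 / 4 : ℝ) ^ n ≤ ε / 4 := by
      have h2 : Tendsto (fun n : ℕ => 2 * (1 / 2 : ℝ) ^ n) atTop (𝓝 (2 * 0)) :=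
        (tendsto_pow_atTop_nhds_zero_of_lt_one (by norm_num) (by norm_num)).const_mul _
      have h4 : Tendsto (fun n : ℕ => 16 * C * (1 / 4 : ℝ) ^ n) atTop (𝓝 (16 * C * 0)) :=
        (tendsto_pow_atTop_nhds_zero_of_lt_one (by norm_num) (by norm_num)).const_mul _
      rw [mul_zero] at h2 h4
      exact (h2.eventually_lt_const hε).and
        (h4.eventually_le_const (by positivity : (0 : ℝ) < ε / 4))
    obtain ⟨n, hn1, hn2⟩ := hsmall.exists
    obtain ⟨hmeas, hlarge⟩ := measureReal_forall_hsSq_ge hm (memLp_orbitFn f) hC0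
      (hπ.condSq_koopman_le hC) hinc n
    obtain ⟨Ξ, hΞ⟩ := exists_net_hsOpLp hm hC0 (hπ.condSq_koopman_le hC) (c n)
      (by positivity : (0 : ℝ) < ε / 4)
    refine ⟨Ξ, _, hmeas, by linarith, fun γ _ => ?_⟩
    have hadd : ∀ ξ ∈ Ξ, ∀ᵐ x ∂μ,
        condSq (mY.comap π) (koopman μ γ F - T γ (c n) + (T γ (c n) - ξ)) x ≤
          2 * condSq (mY.comap π) (koopman μ γ F - T γ (c n)) x +
            2 * condSq (mY.comap π) (T γ (c n) - ξ) x := fun ξ _ => condSq_add_le _ _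
    filter_upwards [hπ.condSq_koopman_sub_le hC0 hC hF γ (htrans γ) n,
      hΞ (koopman μ γ f) (hπ.condSq_koopman_le hC γ) (hπ.memLp_hsOp_orbitFn hC0 hC γ),
      (Finset.eventually_all Ξ).2 hadd] with x h1 ⟨ξ, hξ, h2⟩ h3 hx
    refine ⟨ξ, hξ, ?_⟩
    have h4 := h3 ξ hξ
    have h5 : condSq (mY.comap π) (koopman μ γ F - T γ (c n)) x - 16 * C * (1 / 4) ^ n ≤ 0 := h1 hx
    have h6 : condSq (mY.comap π) (T γ (c n) - ξ) x ≤ ε / 4 := h2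
    rw [sub_add_sub_cancel] at h4
    linarith
  have h0 : Tendsto (fun n => B (c n) (Finsupp.single 1 1)) atTop (𝓝 0) := by
    rw [← hperp F hnets]
    refine (hF.inner tendsto_const_nhds).congr fun n => ?_
    exact hπ.inner_hsOpLp hC0 hC (c n)
  have hlim : Tendsto (fun n => B (c n) (c n)) atTop (𝓝 d) := by
    have h8 : Tendsto (fun n : ℕ => d + (1 / 8 : ℝ) ^ n / 4) atTop (𝓝 (d + 0 / 4)) :=
      ((tendsto_pow_atTop_nhds_zero_of_lt_one (by norm_num) (by norm_num)).div_const 4).const_add d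
    rw [zero_div, add_zero] at h8
    exact tendsto_of_tendsto_of_tendsto_of_le_of_le tendsto_const_nhds h8
      (fun n => hd _ (hc n).1) (fun n => (hc n).2)
  have hdz : d = 0 := min_eq_zero_of_tendsto hd0 hd hsForm_comm (fun n => (hc n).1) hlim
    (totalWeight_single (1 : G)) h0
  rw [hdz] at hlim
  obtain ⟨n, hn⟩ := (hlim.eventually_lt_const hη).exists
  exact ⟨c n, (hc n).1, hn⟩

end Key

/-! ### Weak mixing of functions orthogonal to the almost-periodic ones -/

section Folner

variable {G : Type*} [Group G] [TopologicalSpace G] [IsTopologicalGroup G] [T2Space G]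
  [MeasurableSpace G] [BorelSpace G] {haar : Measure G} [haar.IsHaarMeasure] {Φ : ℕ → Set G}

lemma abs_setIntegral_sub_setIntegral_le {A B : Set G} (hA : IsCompact A) (hB : IsCompact B)
    {D : G → ℝ} (hD : Continuous D) {K : ℝ} (hDK : ∀ g, |D g| ≤ K) :
    |∫ g in A, D g ∂haar - ∫ g in B, D g ∂haar| ≤ K * haar.real (A ∆ B) := by
  have hAm := hA.measurableSet
  have hBm := hB.measurableSet
  have h1 := integral_inter_add_sdiff hBm (hD.continuousOn.integrableOn_compact hA (μ := haar))
  have h2 := integral_inter_add_sdiff hAm (hD.continuousOn.integrableOn_compact hB (μ := haar))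
  have hAf : haar (A \ B) ≠ ∞ := measure_ne_top_of_subset Set.sdiff_subset hA.measure_ne_top
  have hBf : haar (B \ A) ≠ ∞ := measure_ne_top_of_subset Set.sdiff_subset hB.measure_ne_top
  have h3 := norm_setIntegral_le_of_norm_le_const hAf.lt_top (f := D) (C := K) fun g _ => hDK g
  have h4 := norm_setIntegral_le_of_norm_le_const hBf.lt_top (f := D) (C := K) fun g _ => hDK g
  have h5 : haar.real (A ∆ B) = haar.real (A \ B) + haar.real (B \ A) :=
    measureReal_union disjoint_sdiff_sdiff (hBm.diff hAm) hAf hBf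
  rw [Set.inter_comm B A] at h2
  rw [← h1, ← h2, h5, add_sub_add_left_eq_sub, mul_add]
  exact (abs_sub _ _).trans (add_le_add h3 h4)

/-- Averages of a bounded continuous function along a left Følner sequence are asymptotically
invariant under left translation. -/
lemma IsLeftFolner.tendsto_average_sub (hΦ : IsLeftFolner haar Φ) {D : G → ℝ} (hD : Continuous D)
    {K : ℝ} (hDK : ∀ g, |D g| ≤ K) (h : G) :
    Tendsto (fun N => (haar.real (Φ N))⁻¹ * ∫ g in Φ N, D g ∂haar -
      (haar.real (Φ N))⁻¹ * ∫ g in Φ N, D (h * g) ∂haar) atTop (𝓝 0) := by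
  have hK : 0 ≤ K := (abs_nonneg _).trans (hDK 1)
  have hlim := ((ENNReal.tendsto_toReal ENNReal.zero_ne_top).comp (hΦ.tendsto h)).const_mul K
  rw [ENNReal.toReal_zero, mul_zero] at hlim
  refine squeeze_zero_norm (fun N => ?_) hlim
  have hpos : 0 < haar.real (Φ N) :=
    ENNReal.toReal_pos (hΦ.pos N).ne' (hΦ.isCompact N).measure_ne_top
  have hcomp : IsCompact (h • Φ N) := (hΦ.isCompact N).smul h
  have e : ∫ g in Φ N, D (h * g) ∂haar = ∫ g in h • Φ N, D g ∂haar := by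
    rw [← (measurePreserving_mul_left haar h).setIntegral_preimage_emb
      (measurableEmbedding_mulLeft h) D]
    congr 2
    ext g
    simp [Set.mem_smul_set_iff_inv_smul_mem]
  rw [e, ← mul_sub, norm_mul, norm_inv, Real.norm_of_nonneg hpos.le, Real.norm_eq_abs,
    Function.comp_apply, ENNReal.toReal_div, inv_mul_le_iff₀ hpos, ← measureReal_def,
    ← measureReal_def, mul_left_comm, mul_div_cancel₀ _ hpos.ne']
  exact abs_setIntegral_sub_setIntegral_le (hΦ.isCompact N) hcomp hD hDK

end Folner

lemma ae_condInner_self_le {X : Type*} {m mX : MeasurableSpace X} {μ : Measure X}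
    [IsProbabilityMeasure μ] (hm : m ≤ mX) (φ : Lp ℝ ∞ μ) : ∀ᵐ x ∂μ, condInner m μ φ φ x ≤ ‖φ‖ ^ 2 := by
  have h1 : ∀ᵐ x ∂μ, ‖φ x‖ ≤ ‖φ‖ := by
    filter_upwards [ae_le_eLpNormEssSup (f := φ) (μ := μ)] with x hx
    rw [← eLpNorm_exponent_top] at hx
    rw [Lp.norm_def, ← toReal_enorm]
    exact ENNReal.toReal_mono (Lp.eLpNorm_ne_top φ) hx
  have hφ : MemLp φ 2 μ := (Lp.memLp φ).mono_exponent le_top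
  have h2 : (fun x => φ x * φ x) ≤ᵐ[μ] fun _ => ‖φ‖ ^ 2 := by
    filter_upwards [h1] with x hx
    rw [← sq, ← sq_abs]
    exact pow_le_pow_left₀ (abs_nonneg _) hx 2
  have h3 := condExp_mono (m := m) (hφ.integrable_mul hφ) (integrable_const (‖φ‖ ^ 2)) h2
  rwa [condExp_const hm] at h3

section WeakMixing

variable {G X Y : Type*} [Group G] [TopologicalSpace G] [IsTopologicalGroup G] [T2Space G]
  [LocallyCompactSpace G] [SecondCountableTopology G] [MeasurableSpace G] [BorelSpace G]
  {haar : Measure G} [haar.IsHaarMeasure]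
  [mX : MeasurableSpace X] [MeasurableSpace.CountablyGenerated X]
  [mY : MeasurableSpace Y] [MulAction G X] [MeasurableSMul₂ G X]
  [MulAction G Y] [MeasurableSMul₂ G Y]
  {μ : Measure X} [IsProbabilityMeasure μ] [SMulInvariantMeasure G X μ]
  {ν : Measure Y} {π : X → Y} {Γ : Subgroup G} {Φ : ℕ → Set G} {f : Lp ℝ 2 μ} {C : ℝ}

/-- Averages of the mixing integrals are controlled by the Hilbert–Schmidt form. -/
lemma IsFactorMap.linearCombination_condMix_le (hπ : IsFactorMap G μ ν π) (hC0 : 0 ≤ C)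
    (hC : ∀ᵐ x ∂μ, condSq (mY.comap π) f x ≤ C) (φ : Lp ℝ ∞ μ) {c : G →₀ ℝ} {τ : ℝ} (hτ : 0 < τ)
    (hc : hsForm (mY.comap π) μ (orbitFn G f) c c ≤ τ ^ 2) :
    Finsupp.linearCombination ℝ (fun g => condMix (mY.comap π) φ (koopman μ g f)) c ≤
      ‖φ‖ ^ 2 * τ := by
  have hm := hπ.comap_le
  have hφ : MemLp φ 2 μ := (Lp.memLp φ).mono_exponent le_top
  have hi : ∀ g : G, Integrable (fun x => condInner (mY.comap π) μ φ (koopman μ g f) x ^ 2) μ :=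
    fun g => integrable_sq_condInner hm φ _
  have hq := integrable_hsSq hm (memLp_orbitFn f) hC0 (hπ.condSq_koopman_le hC) c
  have e : Finsupp.linearCombination ℝ (fun g => condMix (mY.comap π) φ (koopman μ g f)) c =
      ∫ x, ∑ g ∈ c.support, c g * condInner (mY.comap π) μ φ (koopman μ g f) x ^ 2 ∂μ := by
    rw [integral_finsetSum _ fun g _ => (hi g).const_mul _]
    simp only [integral_const_mul]
    rfl
  rw [e]
  have hbound : ∀ᵐ x ∂μ, ∑ g ∈ c.support, c g * condInner (mY.comap π) μ φ (koopman μ g f) x ^ 2 ≤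
      ‖φ‖ ^ 2 * (τ / 2 + hsSq (mY.comap π) μ (orbitFn G f) c x * (1 / (2 * τ))) := by
    filter_upwards [sq_sum_condInner_sq_le hm (memLp_orbitFn f) hφ c, ae_condInner_self_le hm φ,
      condInner_self_nonneg (m := mY.comap π) (μ := μ) φ, hsSq_nonneg hm (memLp_orbitFn f) c]
      with x h1 h2 h3 h4
    have h3' : (0 : ℝ) ≤ condInner (mY.comap π) μ φ φ x := h3
    have e1 : ∑ g ∈ c.support, c g * condInner (mY.comap π) μ φ (koopman μ g f) x ^ 2 =
        ∑ g ∈ c.support, c g * condInner (mY.comap π) μ (orbitFn G f g) φ x ^ 2 :=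
      Finset.sum_congr rfl fun g _ => by rw [condInner_comm]; rfl
    rw [e1]
    refine (le_abs_self _).trans (abs_le_of_sq_le_sq ?_ (by positivity))
    refine h1.trans ?_
    rw [mul_pow]
    refine mul_le_mul (pow_le_pow_left₀ h3' h2 2) ?_ h4 (by positivity)
    -- the arithmetic–geometric mean inequality
    have e2 : (τ / 2 + hsSq (mY.comap π) μ (orbitFn G f) c x * (1 / (2 * τ))) ^ 2 -
        hsSq (mY.comap π) μ (orbitFn G f) c x =
        (τ / 2 - hsSq (mY.comap π) μ (orbitFn G f) c x * (1 / (2 * τ))) ^ 2 := by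
      field_simp; ring
    nlinarith [sq_nonneg (τ / 2 - hsSq (mY.comap π) μ (orbitFn G f) c x * (1 / (2 * τ)))]
  refine (integral_mono_ae (integrable_finsetSum _ fun g _ => (hi g).const_mul _)
    (((integrable_const _).add (hq.mul_const _)).const_mul _) hbound).trans ?_
  rw [integral_const_mul, integral_add' (integrable_const _) (hq.mul_const _), integral_mul_const,
    integral_hsSq hm (memLp_orbitFn f) hC0 (hπ.condSq_koopman_le hC)]
  refine mul_le_mul_of_nonneg_left ?_ (sq_nonneg _)
  have h1 : hsForm (mY.comap π) μ (orbitFn G f) c c * (1 / (2 * τ)) ≤ τ ^ 2 * (1 / (2 * τ)) :=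
    mul_le_mul_of_nonneg_right hc (by positivity)
  have h2 : τ ^ 2 * (1 / (2 * τ)) = τ / 2 := by field_simp
  simp only [integral_const, probReal_univ, one_smul]
  linarith

/-- Small averages over translates force the averages along every Følner sequence to vanish, because
the latter are asymptotically invariant. -/
lemma IsFactorMap.mem_WM_of_forall_hsForm_lt (hπ : IsFactorMap G μ ν π) (hΦ : IsLeftFolner haar Φ)
    (hC0 : 0 ≤ C) (hC : ∀ᵐ x ∂μ, condSq (mY.comap π) f x ≤ C)
    (h : ∀ η > 0, ∃ c : G →₀ ℝ, totalWeight G c = 1 ∧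
      hsForm (mY.comap π) μ (orbitFn G f) c c < η) : f ∈ WM haar Φ μ π := by
  have hm := hπ.comap_le
  rw [mem_WM_iff]
  intro φ
  set D : G → ℝ := fun g => condMix (mY.comap π) φ (koopman μ g f) with hDdef
  have hD : Continuous D := continuous_condMix_koopman haar hm φ f
  have hD0 : ∀ g, 0 ≤ D g := fun g => condMix_nonneg _ _
  have hDK : ∀ g, |D g| ≤ (‖φ‖ * ‖f‖) ^ 2 := fun g => by
    rw [abs_of_nonneg (hD0 g), ← norm_koopman g f]
    exact condMix_le hm _ _
  rw [Metric.tendsto_atTop']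
  intro ε hε
  set τ : ℝ := ε / (2 * (‖φ‖ ^ 2 + 1)) with hτdef
  have hτ : 0 < τ := by positivity
  have hτε : ‖φ‖ ^ 2 * τ ≤ ε / 2 := by
    have : (‖φ‖ ^ 2 + 1) * τ = ε / 2 := by rw [hτdef]; field_simp
    linarith
  obtain ⟨c, hc1, hc⟩ := h (τ ^ 2) (by positivity)
  have hsmall : ∀ g, ∑ h ∈ c.support, c h * D (h * g) ≤ ε / 2 := fun g => by
    have h1 := hπ.linearCombination_condMix_le hC0 hC φ (c := c.mapDomain (· * g)) hτ
      ((hπ.hsForm_mapDomain f g c c).trans_le hc.le)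
    rw [Finsupp.linearCombination_mapDomain] at h1
    exact h1.trans hτε
  have hlim := tendsto_finsetSum c.support fun h _ =>
    (hΦ.tendsto_average_sub hD hDK h).const_mul (c h)
  simp only [mul_zero, Finset.sum_const_zero] at hlim
  obtain ⟨N₀, hN₀⟩ := eventually_atTop.1 (hlim.eventually_lt_const (half_pos hε))
  refine ⟨N₀, fun N hN => ?_⟩
  have hpos := hΦ.real_pos N
  have hDi : ∀ h : G, IntegrableOn (fun g => D (h * g)) (Φ N) haar := fun h =>
    (hD.comp (continuous_const.mul continuous_id)).continuousOn.integrableOn_compact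
      (hΦ.isCompact N)
  have hw : ∑ h ∈ c.support, c h = 1 := by
    simpa [totalWeight, Finsupp.linearCombination_apply, Finsupp.sum] using hc1
  have hsplit : (haar.real (Φ N))⁻¹ * ∫ g in Φ N, D g ∂haar =
      (∑ h ∈ c.support, c h * ((haar.real (Φ N))⁻¹ * ∫ g in Φ N, D g ∂haar -
        (haar.real (Φ N))⁻¹ * ∫ g in Φ N, D (h * g) ∂haar)) +
      (haar.real (Φ N))⁻¹ * ∫ g in Φ N, (∑ h ∈ c.support, c h * D (h * g)) ∂haar := by
    rw [integral_finsetSum _ fun h _ => (hDi h).const_mul (c h)]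
    simp only [integral_const_mul, mul_sub, Finset.sum_sub_distrib, ← Finset.sum_mul, hw, one_mul,
      Finset.mul_sum]
    rw [sub_add, sub_eq_self.2]
    rw [sub_eq_zero]
    exact Finset.sum_congr rfl fun h _ => by ring
  have havg : (haar.real (Φ N))⁻¹ * ∫ g in Φ N, (∑ h ∈ c.support, c h * D (h * g)) ∂haar ≤
      ε / 2 := by
    rw [inv_mul_le_iff₀ hpos, ← smul_eq_mul, ← setIntegral_const]
    exact setIntegral_mono (integrable_finsetSum _ fun h _ => (hDi h).const_mul (c h))
      (integrableOn_const (hΦ.isCompact N).measure_ne_top) fun g => hsmall g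
  have hnn : 0 ≤ (haar.real (Φ N))⁻¹ * ∫ g in Φ N, D g ∂haar :=
    mul_nonneg (inv_nonneg.2 hpos.le) (integral_nonneg fun g => hD0 g)
  rw [Real.dist_eq, sub_zero, abs_of_nonneg hnn, hsplit]
  have := hN₀ N hN.le
  linarith

lemma mem_WM_of_forall_exists_norm_sub_lt (hm : mY.comap π ≤ mX) (hΦ : IsLeftFolner haar Φ)
    (h : ∀ ε > 0, ∃ f' ∈ WM haar Φ μ π, ‖f - f'‖ < ε) : f ∈ WM haar Φ μ π := by
  rw [mem_WM_iff]
  intro φ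
  rw [Metric.tendsto_atTop]
  intro ε hε
  set δ : ℝ := min 1 (ε / (4 * (‖φ‖ ^ 2 + 1))) with hδdef
  have hδ0 : 0 < δ := lt_min one_pos (by positivity)
  obtain ⟨f', hf', hff'⟩ := h δ hδ0
  obtain ⟨N₀, hN₀⟩ := Metric.tendsto_atTop.1 (mem_WM_iff.1 hf' φ) (ε / 4) (by positivity)
  refine ⟨N₀, fun N hN => ?_⟩
  have h1 := hN₀ N hN
  have hpos := hΦ.real_pos N
  have hnn : ∀ u : Lp ℝ 2 μ, 0 ≤ (haar.real (Φ N))⁻¹ *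
      ∫ g in Φ N, condMix (mY.comap π) φ (koopman μ g u) ∂haar := fun u =>
    mul_nonneg (inv_nonneg.2 hpos.le) (integral_nonneg fun g => condMix_nonneg _ _)
  have hi : ∀ u : Lp ℝ 2 μ,
      IntegrableOn (fun g => condMix (mY.comap π) φ (koopman μ g u)) (Φ N) haar := fun u =>
    (continuous_condMix_koopman haar hm φ u).continuousOn.integrableOn_compact (hΦ.isCompact N)
  rw [Real.dist_eq, sub_zero, abs_of_nonneg (hnn _)] at h1 ⊢
  have hφδ : 2 * (‖φ‖ * δ) ^ 2 < ε / 2 := by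
    have h2 : δ ^ 2 ≤ ε / (4 * (‖φ‖ ^ 2 + 1)) := by
      nlinarith [min_le_left 1 (ε / (4 * (‖φ‖ ^ 2 + 1))), min_le_right 1 (ε / (4 * (‖φ‖ ^ 2 + 1)))]
    have h3 : (‖φ‖ ^ 2 + 1) * (ε / (4 * (‖φ‖ ^ 2 + 1))) = ε / 4 := by field_simp
    have h4 := mul_le_mul_of_nonneg_left h2 (by positivity : 0 ≤ ‖φ‖ ^ 2 + 1)
    have h5 : 0 < δ ^ 2 := by positivity
    rw [mul_pow]
    nlinarith
  have hpt : ∀ g : G, condMix (mY.comap π) φ (koopman μ g f) ≤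
      2 * condMix (mY.comap π) φ (koopman μ g f') + ε / 2 := fun g => by
    have h2 := condMix_add_le hm φ (koopman μ g f') (koopman μ g (f - f'))
    rw [← koopman_add, add_sub_cancel] at h2
    have h3 := condMix_le hm φ (koopman μ g (f - f'))
    rw [norm_koopman] at h3
    have h4 : (‖φ‖ * ‖f - f'‖) ^ 2 ≤ (‖φ‖ * δ) ^ 2 :=
      pow_le_pow_left₀ (by positivity) (mul_le_mul_of_nonneg_left hff'.le (norm_nonneg _)) 2
    linarith
  have h2 : ∫ g in Φ N, condMix (mY.comap π) φ (koopman μ g f) ∂haar ≤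
      2 * ∫ g in Φ N, condMix (mY.comap π) φ (koopman μ g f') ∂haar + haar.real (Φ N) * (ε / 2) := by
    rw [← integral_const_mul, ← smul_eq_mul (haar.real (Φ N)), ← setIntegral_const,
      ← integral_add ((hi f').const_mul 2) (integrableOn_const (hΦ.isCompact N).measure_ne_top)]
    exact setIntegral_mono (hi f) (((hi f').const_mul 2).add
      (integrableOn_const (hΦ.isCompact N).measure_ne_top)) hpt
  calc _ ≤ (haar.real (Φ N))⁻¹ * (2 * ∫ g in Φ N, condMix (mY.comap π) φ (koopman μ g f') ∂haar +
        haar.real (Φ N) * (ε / 2)) := mul_le_mul_of_nonneg_left h2 (inv_nonneg.2 hpos.le)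
    _ = 2 * ((haar.real (Φ N))⁻¹ * ∫ g in Φ N, condMix (mY.comap π) φ (koopman μ g f') ∂haar) +
        ε / 2 := by field_simp
    _ < ε := by linarith

lemma inner_indicatorL2 {B : Set X} (hB : MeasurableSet B) (u w : Lp ℝ 2 μ) :
    inner ℝ u (indicatorL2 hB w) = inner ℝ (indicatorL2 hB u) w := by
  rw [L2.inner_def, L2.inner_def]
  refine integral_congr_ae ?_
  filter_upwards [coeFn_indicatorL2 hB u, coeFn_indicatorL2 hB w] with x h1 h2
  rw [h1, h2]
  by_cases hx : x ∈ B <;> simp [hx]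

/-- Functions with bounded fibre norms, obtained by restriction to sublevel sets of the fibre norm,
approximate every function in `L²`. -/
lemma exists_norm_sub_indicatorL2_lt (hm : mY.comap π ≤ mX) (f : Lp ℝ 2 μ) {ε : ℝ} (hε : 0 < ε) :
    ∃ (C : ℝ) (B : Set X) (hB : MeasurableSet[mY.comap π] B), 0 ≤ C ∧
      (∀ᵐ x ∂μ, condSq (mY.comap π) (indicatorL2 (hm B hB) f) x ≤ C) ∧
      ‖f - indicatorL2 (hm B hB) f‖ < ε := by
  let B : ℕ → Set X := fun n => {x | condSq (mY.comap π) f x ≤ n}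
  have hB : ∀ n, MeasurableSet[mY.comap π] (B n) := fun n =>
    (stronglyMeasurable_condSq (m := mY.comap π) f).measurable measurableSet_Iic
  have hlim : Tendsto (fun n => ‖f - indicatorL2 (hm _ (hB n)) f‖ ^ 2) atTop (𝓝 0) := by
    have e : ∀ n, ‖f - indicatorL2 (hm _ (hB n)) f‖ ^ 2 =
        ∫ x, (B n)ᶜ.indicator (fun x => f x * f x) x ∂μ := fun n => by
      rw [← integral_mul_self_eq_norm_sq]
      refine integral_congr_ae ?_
      filter_upwards [Lp.coeFn_sub f (indicatorL2 (hm _ (hB n)) f),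
        coeFn_indicatorL2 (hm _ (hB n)) f] with x h1 h2
      rw [h1, Pi.sub_apply, h2]
      by_cases hx : x ∈ B n <;> simp [hx]
    simp only [e]
    have hff : Integrable (fun x => f x * f x) μ := (Lp.memLp f).integrable_mul (Lp.memLp f)
    rw [← integral_zero X ℝ (μ := μ)]
    refine tendsto_integral_of_dominated_convergence (fun x => ‖f x * f x‖)
      (fun n => (hff.indicator (hm _ (hB n)).compl).aestronglyMeasurable) hff.norm
      (fun n => Eventually.of_forall fun x => norm_indicator_le_norm_self _ _)
      (Eventually.of_forall fun x => ?_)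
    refine tendsto_const_nhds.congr' ?_
    obtain ⟨n₀, hn₀⟩ := exists_nat_ge (condSq (mY.comap π) f x)
    filter_upwards [eventually_ge_atTop n₀] with n hn
    have hx : x ∈ B n := hn₀.trans (Nat.cast_le.2 hn)
    simp [hx]
  obtain ⟨n, hn⟩ := (hlim.eventually_lt_const (by positivity : (0 : ℝ) < ε ^ 2)).exists
  refine ⟨n, B n, hB n, Nat.cast_nonneg n, ?_, lt_of_pow_lt_pow_left₀ 2 hε.le hn⟩
  have hin : ∀ᵐ x ∂μ, x ∈ B n → condSq (mY.comap π) (indicatorL2 (hm _ (hB n)) f) x =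
      condSq (mY.comap π) f x := by
    refine condSq_eq_of_eq_on (hB n) ?_
    filter_upwards [coeFn_indicatorL2 (hm _ (hB n)) f] with x h1 hx
    rw [h1, Set.indicator_of_mem hx]
  have hout : ∀ᵐ x ∂μ, x ∈ (B n)ᶜ →
      condSq (mY.comap π) (indicatorL2 (hm _ (hB n)) f) x = 0 := by
    refine condSq_eq_zero_of_eq_zero_on (hB n).compl ?_
    filter_upwards [coeFn_indicatorL2 (hm _ (hB n)) f] with x h1 hx
    rw [h1, Set.indicator_of_notMem hx]
  filter_upwards [hin, hout] with x h1 h2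
  by_cases hx : x ∈ B n
  · rw [h1 hx]; exact hx
  · rw [h2 hx]; exact Nat.cast_nonneg n

/-- Every function orthogonal to the almost-periodic ones is weakly mixing. -/
theorem IsFactorMap.mem_WM_of_forall_inner_eq_zero (hπ : IsFactorMap G μ ν π)
    (hΦ : IsLeftFolner haar Φ)
    (hf : ∀ F : Lp ℝ 2 μ, IsAlmostPeriodic Γ μ ν π F → inner ℝ F f = 0) : f ∈ WM haar Φ μ π := by
  have hm := hπ.comap_le
  refine mem_WM_of_forall_exists_norm_sub_lt hm hΦ fun ε hε => ?_
  obtain ⟨C, B, hB, hC0, hC, hlt⟩ := exists_norm_sub_indicatorL2_lt hm f hε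
  refine ⟨_, hπ.mem_WM_of_forall_hsForm_lt hΦ hC0 hC fun η hη =>
    hπ.exists_hsForm_lt Γ hC0 hC (fun F hF => ?_) hη, hlt⟩
  rw [inner_indicatorL2]
  exact hf _ ((isAlmostPeriodic_iff hπ.measurePreserving _).2
    (hF.indicator hm hπ.measurable_smul_comap hB))

end WeakMixing

end

theorem mainTheorem7
    {G : Type*} [Group G] [TopologicalSpace G] [IsTopologicalGroup G] [T2Space G]
    [LocallyCompactSpace G] [SecondCountableTopology G] [MeasurableSpace G] [BorelSpace G]
    (haar : Measure G) [haar.IsHaarMeasure]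
    (Γ : Subgroup G) (hΓcount : Countable Γ) (hΓdense : Dense (Γ : Set G))
    {X : Type*} [MeasurableSpace X] [MeasurableSpace.CountablyGenerated X]
    [MeasurableSpace.SeparatesPoints X] [MulAction G X] [MeasurableSMul₂ G X]
    (μ : Measure X) [IsProbabilityMeasure μ] [SMulInvariantMeasure G X μ]
    {Y : Type*} [MeasurableSpace Y] [MeasurableSpace.CountablyGenerated Y]
    [MeasurableSpace.SeparatesPoints Y] [MulAction G Y] [MeasurableSMul₂ G Y]
    (ν : Measure Y) [IsProbabilityMeasure ν] [SMulInvariantMeasure G Y ν]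
    (π : X → Y) (hπ : IsFactorMap G μ ν π)
    (Φ : ℕ → Set G) (hΦ : IsLeftFolner haar Φ) :
    (∃ A W : Submodule ℝ (Lp ℝ 2 μ),
      (A : Set (Lp ℝ 2 μ)) = AP Γ μ ν π ∧
      (W : Set (Lp ℝ 2 μ)) = WM haar Φ μ π ∧
      IsClosed (A : Set (Lp ℝ 2 μ)) ∧ IsClosed (W : Set (Lp ℝ 2 μ)) ∧
      A ⟂ W ∧ A ⊔ W = ⊤) ∧
    ∀ Ψ : ℕ → Set G, IsLeftFolner haar Ψ → WM haar Ψ μ π = WM haar Φ μ π := by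
  have hm := hπ.comap_le
  have hiff : ∀ f : Lp ℝ 2 μ, IsAlmostPeriodic Γ μ ν π f ↔ _ :=
    isAlmostPeriodic_iff hπ.measurePreserving
  let S : Submodule ℝ (Lp ℝ 2 μ) :=
    { carrier := {f | IsAlmostPeriodic Γ μ ν π f}
      add_mem' := fun ha hb => (hiff _).2 (((hiff _).1 ha).add hm ((hiff _).1 hb))
      zero_mem' := (hiff _).2 hasFibreNets_zero
      smul_mem' := fun c _ ha => (hiff _).2 (((hiff _).1 ha).smul c) }
  have hWM : ∀ Ψ : ℕ → Set G, IsLeftFolner haar Ψ →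
      ((S.topologicalClosureᗮ : Submodule ℝ (Lp ℝ 2 μ)) : Set (Lp ℝ 2 μ)) = WM haar Ψ μ π := by
    intro Ψ hΨ
    rw [Submodule.orthogonal_closure]
    ext f
    refine ⟨fun hf => ?_, fun hf => ?_⟩
    · exact hπ.mem_WM_of_forall_inner_eq_zero hΨ fun F hF =>
        (Submodule.mem_orthogonal S f).1 hf F hF
    · exact (Submodule.mem_orthogonal S f).2 fun F hF =>
        inner_eq_zero_of_isAlmostPeriodic_of_mem_WM hπ.measurePreserving hΓdense hΨ hF hf
  have hcomplete : IsComplete (S.topologicalClosure : Set (Lp ℝ 2 μ)) :=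
    S.isClosed_topologicalClosure.isComplete
  have : CompleteSpace S.topologicalClosure := hcomplete.completeSpace_coe
  refine ⟨⟨S.topologicalClosure, S.topologicalClosureᗮ, S.topologicalClosure_coe, hWM Φ hΦ,
    S.isClosed_topologicalClosure, Submodule.isClosed_orthogonal _,
    Submodule.isOrtho_orthogonal_right _, Submodule.sup_orthogonal_of_hasOrthogonalProjection⟩,
    fun Ψ hΨ => (hWM Ψ hΨ).symm.trans (hWM Φ hΦ)⟩
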